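/- Let $\mathbb{T}$ be the unit circle with normalized Lebesgue measure $d\theta/2\pi$, let $I\subset\mathbb{T}$ be a finite union of at least one nonempty open arc, and suppose that $J=\mathbb{T}\setminus I$ has nonempty interior. Let $H^2$ be the space of those functions in $L^2(\mathbb{T})$ whose Fourier coefficients of strictly negative index all vanish, and for each integer $n\ge 0$ let $P_n$ be the space of complex polynomials of degree at most $n$. Let $f\in L^2(I)$ (complex-valued). Then: (i) For every integer $n\ge 0$ there is a unique $k_n\in P_n$ with $|k_n|\le 1$ a.e. on $J$ such that $$\|f-k_n\|_{L^2(I)}=\inf\{\|f-g\|_{L^2(I)}:\ g\in P_n,\ |g|\le 1\text{ a.e. on }J\}.$$ (ii) There is a unique $g_0\in H^2$ with $|g_0|\le 1$ a.e. on $J$ such that $$\|f-g_0\|_{L^2(I)}=\inf\{\|f-g\|_{L^2(I)}:\ g\in H^2,\ |g|\le 1\text{ a.e. on }J\}.$$ (iii) The solution $g_0$ in (ii) satisfies $|g_0|=1$ a.e. on $J$, unless $f=g|_I$ a.e. for some $g\in H^2$ with $\|g\|_{L^\infty(J)}\le 1$. -/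

import Mathlib

open MeasureTheory
open scoped ENNReal Real

/-- The unit circle, parametrized by the angle `θ ∈ ℝ / 2πℤ`; the corresponding point of the
complex plane is `AddCircle.toCircle θ = e^{iθ}` (see `toCircle_coe` below). -/
abbrev UCircle : Type := AddCircle (2 * π)

instance factTwoPiPos : Fact (0 < 2 * π) := ⟨Real.two_pi_pos⟩

/-- The normalized Lebesgue measure `dθ / 2π` on the circle (see `circleMeasure_eq` below). -/
noncomputable abbrev circleMeasure : Measure UCircle := AddCircle.haarAddCircle

theorem toCircle_coe (θ : ℝ) :
    ((AddCircle.toCircle (θ : UCircle) : Circle) : ℂ) = Complex.exp (θ * Complex.I) := by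
  rw [AddCircle.toCircle_apply_mk, Circle.coe_exp, div_self (by positivity), one_mul]

theorem circleMeasure_eq :
    (volume : Measure UCircle) = ENNReal.ofReal (2 * π) • circleMeasure :=
  AddCircle.volume_eq_smul_haarAddCircle

/-- A nonempty open arc of the circle: the set of points `e^{iθ}` with `a < θ < b`, where
`a < b ≤ a + 2π`. -/
def IsOpenArc (A : Set UCircle) : Prop :=
  ∃ a b : ℝ, a < b ∧ b ≤ a + 2 * π ∧ A = (fun θ : ℝ => (θ : UCircle)) '' Set.Ioo a b

/-- A finite union of (at least one) nonempty open arcs of the circle. -/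
def IsFiniteUnionOfOpenArcs (I : Set UCircle) : Prop :=
  ∃ S : Set (Set UCircle), S.Finite ∧ S.Nonempty ∧ (∀ A ∈ S, IsOpenArc A) ∧ I = ⋃₀ S

/-- The Hardy space `H²`: those elements of `L²` of the circle all of whose Fourier coefficients
of strictly negative index vanish. -/
def hardyH2 : Set (Lp ℂ 2 circleMeasure) :=
  {g | ∀ m : ℤ, m < 0 → fourierCoeff g m = 0}

/-- The trace on the unit circle of a complex polynomial, `θ ↦ p(e^{iθ})`. -/
noncomputable def polyTrace (p : Polynomial ℂ) : UCircle → ℂ :=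
  fun θ => p.eval ((AddCircle.toCircle θ : Circle) : ℂ)

/-- `|u| ≤ 1` almost everywhere on `J`. -/
def BoundedByOneOn (J : Set UCircle) (u : UCircle → ℂ) : Prop :=
  ∀ᵐ θ ∂(circleMeasure.restrict J), ‖u θ‖ ≤ 1

/-- The error `‖f - u‖` in `L²(I)`. -/
noncomputable def errorOn (I : Set UCircle) (f u : UCircle → ℂ) : ℝ≥0∞ :=
  eLpNorm (fun θ => f θ - u θ) 2 (circleMeasure.restrict I)

/-- The candidate approximants of the polynomial problem: complex polynomials of degree at most
`n` which are bounded by `1` on `J`. -/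
def polyCandidates (J : Set UCircle) (n : ℕ) : Set (Polynomial ℂ) :=
  {p | p.natDegree ≤ n ∧ BoundedByOneOn J (polyTrace p)}

/-- The candidate approximants of the analytic problem: functions in `H²` which are bounded by `1`
almost everywhere on `J`. -/
def analyticCandidates (J : Set UCircle) : Set (Lp ℂ 2 circleMeasure) :=
  {g | g ∈ hardyH2 ∧ BoundedByOneOn J g}

/-- `k` is a solution of the polynomial bounded extremal problem of degree `n` for `f ∈ L²(I)`,
the constraint being imposed on the complement of `I`. -/
def IsPBEPSolution (I : Set UCircle) (n : ℕ) (f : Lp ℂ 2 (circleMeasure.restrict I))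
    (k : Polynomial ℂ) : Prop :=
  k ∈ polyCandidates Iᶜ n ∧
    errorOn I f (polyTrace k) = ⨅ p ∈ polyCandidates Iᶜ n, errorOn I f (polyTrace p)

/-- `g₀` is a solution of the analytic bounded extremal problem for `f ∈ L²(I)`,
the constraint being imposed on the complement of `I`. -/
def IsABEPSolution (I : Set UCircle) (f : Lp ℂ 2 (circleMeasure.restrict I))
    (g₀ : Lp ℂ 2 circleMeasure) : Prop :=
  g₀ ∈ analyticCandidates Iᶜ ∧
    errorOn I f g₀ = ⨅ g ∈ analyticCandidates Iᶜ, errorOn I f g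

open Filter Topology

/-! ### Hardy space basics -/

/-! Write `J` for the complement of `I`. Existence: the candidates form a closed convex set in `L²`,
and since `|g| ≤ 1` on `J`, a bound on the error on `I` bounds the whole norm of `g`. The sublevel
sets of the error are therefore bounded, closed and convex, and a nested sequence of them has a
common point. Uniqueness: by the parallelogram law two minimizers agree on `I`, and a function of
`H²` vanishing on a set of positive measure is zero (`eq_zero_of_vanishes`). Polynomials of degree
at most `n` are covered by intersecting with a closed finite-dimensional subspace.

Saturation: suppose the solution satisfies `|g| ≤ 1 - ε` on some `E ⊆ J` of positive measure. For a
bounded `m ∈ H²` with `|m| ≤ η` on `J \ E`, the function `g (1 + t (m - η))` is admissible for small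
`t > 0`, so minimality gives `Re ∫_I conj(f - g) g m ≤ c η` with `c` independent of `m`. The outer
functions `m = exp (ψ + i ψ̃)` can have modulus one on `I`, be as small as desired on `J \ E`, and
approximate any prescribed measurable phase on `I`. Hence `∫_I |(f - g) g| = 0`
(`ae_eq_zero_of_pairing_le`). As `g` is nonzero a.e. unless `g = 0`, it follows that `f = g` on `I`;
the case `g = 0` uses additive perturbations instead.

The phases are obtained by duality (`mem_closure_analyticCompletion`): if a real `a` supported in
`I` is orthogonal to the conjugates of all bounded real functions on `E`, then `ã = 0` on `E` by
skew-symmetry. So `a + i ã` is in `H²` and vanishes on `E`, which forces `a = 0`. -/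

theorem fourierCoeff_eq_inner (g : Lp ℂ 2 circleMeasure) (n : ℤ) :
    fourierCoeff g n = inner ℂ (fourierLp 2 n) g := by
  rw [← fourierBasis_repr, HilbertBasis.repr_apply_apply, coe_fourierBasis]

theorem fourierCoeff_zero_eq_integral (g : UCircle → ℂ) :
    fourierCoeff g 0 = ∫ θ, g θ ∂circleMeasure := by
  simp [fourierCoeff]

/-- The Hardy space as a submodule of `L²`. -/
noncomputable def hardySubmodule : Submodule ℂ (Lp ℂ 2 circleMeasure) where
  carrier := hardyH2
  add_mem' := by
    intro a b ha hb m hm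
    have h1 := ha m hm
    have h2 := hb m hm
    rw [fourierCoeff_eq_inner] at *
    rw [inner_add_right, h1, h2, add_zero]
  zero_mem' := by
    intro m hm
    rw [fourierCoeff_eq_inner, inner_zero_right]
  smul_mem' := by
    intro c a ha m hm
    have h1 := ha m hm
    rw [fourierCoeff_eq_inner] at *
    rw [inner_smul_right, h1, mul_zero]

theorem isClosed_hardyH2 : IsClosed hardyH2 := by
  have : hardyH2 = ⋂ m : ℤ, ⋂ _ : m < 0,
      {g : Lp ℂ 2 circleMeasure | inner ℂ (fourierLp 2 m) g = 0} := by
    ext g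
    simp [hardyH2, fourierCoeff_eq_inner]
  rw [this]
  exact isClosed_iInter fun m => isClosed_iInter fun _ =>
    isClosed_eq (continuous_const.inner continuous_id) continuous_const

instance : CompleteSpace hardySubmodule :=
  completeSpace_coe_iff_isComplete.2 isClosed_hardyH2.isComplete

theorem fourierLp_mem_hardyH2 {n : ℤ} (hn : 0 ≤ n) :
    (fourierLp 2 n : Lp ℂ 2 circleMeasure) ∈ hardyH2 := by
  intro m hm
  rw [fourierCoeff_eq_inner]
  exact orthonormal_fourier.2 (by omega)

theorem integrable_mul_of_Lp (g u : Lp ℂ 2 circleMeasure) :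
    Integrable (fun θ => g θ * u θ) circleMeasure :=
  (Lp.memLp g).integrable_mul (Lp.memLp u)

/-- Parseval for `star g` and `u`: the `n`-th term is `ĝ(-n) û(n)`, and one factor vanishes unless
`n = 0`. -/
theorem integral_mul_of_mem_hardyH2 {g u : Lp ℂ 2 circleMeasure} (hg : g ∈ hardyH2)
    (hu : u ∈ hardyH2) :
    ∫ θ, g θ * u θ ∂circleMeasure = fourierCoeff g 0 * fourierCoeff u 0 := by
  have h1 : inner ℂ (star g) u = ∫ θ, g θ * u θ ∂circleMeasure := by
    rw [L2.inner_def]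
    refine integral_congr_ae ?_
    filter_upwards [Lp.coeFn_star g] with θ hθ
    rw [hθ]
    simp [mul_comm]
  have h2 : ∀ n : ℤ, inner ℂ (star g) (fourierLp 2 n : Lp ℂ 2 circleMeasure)
      = fourierCoeff g (-n) := by
    intro n
    rw [L2.inner_def, fourierCoeff]
    refine integral_congr_ae ?_
    filter_upwards [Lp.coeFn_star g, coeFn_fourierLp 2 n] with θ hθ h'
    rw [hθ, h']
    simp
  rw [← h1, ← fourierBasis.tsum_inner_mul_inner (star g) u, tsum_eq_single 0]
  · rw [coe_fourierBasis, h2, ← fourierCoeff_eq_inner, neg_zero]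
  · intro n hn
    rw [coe_fourierBasis, h2, ← fourierCoeff_eq_inner]
    rcases lt_or_gt_of_ne hn with h | h
    · rw [hu n h, mul_zero]
    · rw [hg (-n) (by omega), zero_mul]

/-- Multiplication by `e^{inθ}` on `L²`. -/
theorem exists_fourier_mul (g : Lp ℂ 2 circleMeasure) (n : ℤ) :
    ∃ h : Lp ℂ 2 circleMeasure, h =ᵐ[circleMeasure] (fun θ => fourier n θ * g θ) ∧
      ∀ m, fourierCoeff h m = fourierCoeff g (m - n) := by
  have hm : MemLp (fun θ => fourier n θ * g θ) 2 circleMeasure := by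
    refine (Lp.memLp g).of_le ?_ ?_
    · exact ((fourier n).continuous.aestronglyMeasurable).mul (Lp.aestronglyMeasurable g)
    · filter_upwards with θ
      rw [norm_mul, fourier_apply, Circle.norm_coe, one_mul]
  refine ⟨hm.toLp _, hm.coeFn_toLp, fun m => ?_⟩
  rw [fourierCoeff_congr_ae hm.coeFn_toLp]
  simp only [fourierCoeff]
  congr 1
  ext θ
  rw [smul_eq_mul, smul_eq_mul, ← mul_assoc, ← fourier_add]
  congr 3
  ring

/-- For `m < 0` the coefficient of index `m` is the mean of `(e^{-imθ} g) u`, a product of two Hardy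
functions the first of which has mean zero. -/
theorem mem_hardyH2_of_ae_eq_mul {g u h : Lp ℂ 2 circleMeasure} (hg : g ∈ hardyH2)
    (hu : u ∈ hardyH2) (hh : h =ᵐ[circleMeasure] fun θ => g θ * u θ) :
    h ∈ hardyH2 := by
  intro m hm
  obtain ⟨k, hk, hk'⟩ := exists_fourier_mul g (-m)
  have hkm : k ∈ hardyH2 := fun j hj => by rw [hk']; exact hg _ (by omega)
  have := integral_mul_of_mem_hardyH2 hkm hu
  rw [hk', zero_sub, neg_neg, hg m hm, zero_mul] at this
  rw [← this, fourierCoeff]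
  refine integral_congr_ae ?_
  filter_upwards [hk, hh] with θ h1 h2
  rw [h1, h2, smul_eq_mul, mul_assoc]

/-! ### The analytic completion of an `L²` function -/

/-- The operator `ψ ↦ 2 P₊ψ - ψ̂(0)`, which sends a real function `ψ` to `ψ + i ψ̃`,
where `ψ̃` is the conjugate function. -/
noncomputable def analyticCompletion : Lp ℂ 2 circleMeasure →L[ℂ] Lp ℂ 2 circleMeasure :=
  (2 : ℂ) • hardySubmodule.starProjection -
    (innerSL ℂ (fourierLp 2 0 : Lp ℂ 2 circleMeasure)).smulRight (fourierLp 2 0)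

theorem analyticCompletion_apply (ψ : Lp ℂ 2 circleMeasure) :
    analyticCompletion ψ = (2 : ℂ) • hardySubmodule.starProjection ψ -
      fourierCoeff ψ 0 • (fourierLp 2 0 : Lp ℂ 2 circleMeasure) := by
  rw [fourierCoeff_eq_inner]
  rfl

theorem analyticCompletion_mem (ψ : Lp ℂ 2 circleMeasure) : analyticCompletion ψ ∈ hardyH2 := by
  rw [analyticCompletion_apply]
  exact hardySubmodule.sub_mem (hardySubmodule.smul_mem _ (Submodule.starProjection_apply_mem _ _))
    (hardySubmodule.smul_mem _ (fourierLp_mem_hardyH2 le_rfl))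

theorem fourierCoeff_starProjection (ψ : Lp ℂ 2 circleMeasure) {n : ℤ} (hn : 0 ≤ n) :
    fourierCoeff (hardySubmodule.starProjection ψ) n = fourierCoeff ψ n := by
  rw [fourierCoeff_eq_inner, fourierCoeff_eq_inner]
  have := Submodule.starProjection_inner_eq_zero (K := hardySubmodule) ψ _ (fourierLp_mem_hardyH2 hn)
  rw [inner_sub_left, sub_eq_zero] at this
  rw [← inner_conj_symm, ← this, inner_conj_symm]

theorem inner_fourierLp (m n : ℤ) :
    inner ℂ (fourierLp 2 m : Lp ℂ 2 circleMeasure) (fourierLp 2 n) = if m = n then 1 else 0 :=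
  orthonormal_iff_ite.1 orthonormal_fourier m n

theorem fourierCoeff_analyticCompletion_of_pos (ψ : Lp ℂ 2 circleMeasure) {n : ℤ} (hn : 0 < n) :
    fourierCoeff (analyticCompletion ψ) n = 2 * fourierCoeff ψ n := by
  rw [fourierCoeff_eq_inner, analyticCompletion_apply, inner_sub_right, inner_smul_right,
    inner_smul_right, ← fourierCoeff_eq_inner, fourierCoeff_starProjection ψ hn.le,
    inner_fourierLp, if_neg hn.ne', mul_zero, sub_zero]

theorem fourierCoeff_analyticCompletion_zero (ψ : Lp ℂ 2 circleMeasure) :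
    fourierCoeff (analyticCompletion ψ) 0 = fourierCoeff ψ 0 := by
  rw [fourierCoeff_eq_inner, analyticCompletion_apply, inner_sub_right, inner_smul_right,
    inner_smul_right, ← fourierCoeff_eq_inner, fourierCoeff_starProjection ψ le_rfl,
    inner_fourierLp, if_pos rfl]
  ring

theorem fourierCoeff_star (g : Lp ℂ 2 circleMeasure) (n : ℤ) :
    fourierCoeff (star g : Lp ℂ 2 circleMeasure) n = star (fourierCoeff g (-n)) := by
  rw [fourierCoeff, fourierCoeff]
  simp only [RCLike.star_def]
  rw [← integral_conj]
  refine integral_congr_ae ?_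
  filter_upwards [Lp.coeFn_star g] with θ hθ
  rw [hθ]
  simp

theorem ext_fourierCoeff {g h : Lp ℂ 2 circleMeasure}
    (H : ∀ n, fourierCoeff g n = fourierCoeff h n) : g = h := by
  apply fourierBasis.repr.injective
  ext n
  rw [fourierBasis_repr, fourierBasis_repr, H]

theorem fourierCoeff_Lp_add (g h : Lp ℂ 2 circleMeasure) (n : ℤ) :
    fourierCoeff ↑(g + h) n = fourierCoeff g n + fourierCoeff h n := by
  simp only [fourierCoeff_eq_inner, inner_add_right]

theorem fourierCoeff_Lp_smul (c : ℂ) (h : Lp ℂ 2 circleMeasure) (n : ℤ) :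
    fourierCoeff ↑(c • h) n = c * fourierCoeff h n := by
  simp only [fourierCoeff_eq_inner, inner_smul_right]

/-- The function takes real values almost everywhere. -/
def AERealValued (ψ : Lp ℂ 2 circleMeasure) : Prop := ∀ᵐ θ ∂circleMeasure, (ψ θ).im = 0

theorem AERealValued.star_eq {ψ : Lp ℂ 2 circleMeasure} (h : AERealValued ψ) : star ψ = ψ := by
  ext1
  filter_upwards [h, Lp.coeFn_star ψ] with θ h1 h2
  rw [h2]
  exact Complex.conj_eq_iff_im.2 h1

/-- Twice the real part is compared with `2ψ` coefficient by coefficient; reality of `ψ` means that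
`ψ̂(-n)` is the conjugate of `ψ̂(n)`. -/
theorem re_analyticCompletion {ψ : Lp ℂ 2 circleMeasure} (h : AERealValued ψ) :
    ∀ᵐ θ ∂circleMeasure, (analyticCompletion ψ θ).re = (ψ θ).re := by
  have key : analyticCompletion ψ + star (analyticCompletion ψ) = (2 : ℂ) • ψ := by
    apply ext_fourierCoeff
    intro n
    rw [fourierCoeff_Lp_add, fourierCoeff_Lp_smul, fourierCoeff_star]
    have hs := fourierCoeff_star ψ n
    rw [h.star_eq] at hs
    rcases lt_trichotomy n 0 with hn | rfl | hn
    · rw [analyticCompletion_mem ψ n hn,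
        fourierCoeff_analyticCompletion_of_pos ψ (show 0 < -n by omega), star_mul, ← hs]
      simp [mul_comm]
    · rw [neg_zero] at hs ⊢
      rw [fourierCoeff_analyticCompletion_zero, ← hs]
      ring
    · rw [analyticCompletion_mem ψ (-n) (by omega),
        fourierCoeff_analyticCompletion_of_pos ψ hn, star_zero, add_zero]
  have h1 := Lp.coeFn_add (analyticCompletion ψ) (star (analyticCompletion ψ))
  rw [key] at h1
  filter_upwards [h1, Lp.coeFn_smul (2 : ℂ) ψ, Lp.coeFn_star (analyticCompletion ψ)]
    with θ h1 h2 h3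
  rw [h2, Pi.add_apply, h3] at h1
  have := congrArg Complex.re h1
  simp at this
  linarith

/-! ### Exponentials of analytic completions -/

/-- A continuous function on the circle as an element of `L²`. -/
noncomputable abbrev contToL2 : C(UCircle, ℂ) →L[ℂ] Lp ℂ 2 circleMeasure :=
  ContinuousMap.toLp 2 circleMeasure ℂ

theorem coeFn_contToL2 (d : C(UCircle, ℂ)) : contToL2 d =ᵐ[circleMeasure] d :=
  ContinuousMap.coeFn_toLp circleMeasure d

theorem fourierCoeff_contToL2 (d : C(UCircle, ℂ)) (n : ℤ) :
    fourierCoeff (contToL2 d) n = fourierCoeff d n :=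
  congrFun (fourierCoeff_congr_ae (coeFn_contToL2 d)) n

theorem contToL2_mul_ae (d e : C(UCircle, ℂ)) :
    contToL2 (d * e) =ᵐ[circleMeasure] fun θ => contToL2 d θ * contToL2 e θ := by
  filter_upwards [coeFn_contToL2 d, coeFn_contToL2 e, coeFn_contToL2 (d * e)] with θ h1 h2 h3
  rw [h1, h2, h3, ContinuousMap.mul_apply]

/-- The disc algebra, as the algebra of continuous functions on the circle which belong
to the Hardy space. -/
noncomputable def discAlgebra : Subalgebra ℂ C(UCircle, ℂ) where
  carrier := {d | contToL2 d ∈ hardyH2}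
  mul_mem' := fun {d e} hd he => mem_hardyH2_of_ae_eq_mul hd he (contToL2_mul_ae d e)
  add_mem' := fun {d e} hd he => by
    rw [Set.mem_ofPred_eq, map_add]
    exact hardySubmodule.add_mem hd he
  algebraMap_mem' := fun c => by
    have : algebraMap ℂ C(UCircle, ℂ) c = c • fourier 0 := by
      ext θ
      simp
    rw [this, Set.mem_ofPred_eq, map_smul]
    exact hardySubmodule.smul_mem _ (fourierLp_mem_hardyH2 le_rfl)

theorem isClosed_discAlgebra : IsClosed (discAlgebra : Set C(UCircle, ℂ)) :=
  isClosed_hardyH2.preimage contToL2.continuous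

theorem exp_mem_discAlgebra {d : C(UCircle, ℂ)} (hd : d ∈ discAlgebra) :
    NormedSpace.exp d ∈ discAlgebra :=
  NormedSpace.exp_mem (R := ℂ) isClosed_discAlgebra hd

theorem continuousMap_exp_apply (d : C(UCircle, ℂ)) (θ : UCircle) :
    (NormedSpace.exp d : C(UCircle, ℂ)) θ = Complex.exp (d θ) := by
  have := NormedSpace.map_exp (ContinuousMap.evalAlgHom ℂ ℂ θ) (continuous_eval_const θ) d
  rw [Complex.exp_eq_exp_ℂ]
  exact this

theorem integral_pow_of_mem_discAlgebra {d : C(UCircle, ℂ)} (hd : d ∈ discAlgebra) (n : ℕ) :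
    ∫ θ, d θ ^ n ∂circleMeasure = (∫ θ, d θ ∂circleMeasure) ^ n := by
  induction n with
  | zero => simp
  | succ n ih =>
    have := integral_mul_of_mem_hardyH2 (discAlgebra.pow_mem hd n) hd
    rw [fourierCoeff_contToL2, fourierCoeff_contToL2, fourierCoeff_zero_eq_integral,
      fourierCoeff_zero_eq_integral] at this
    simp only [ContinuousMap.pow_apply] at this
    rw [ih] at this
    rw [pow_succ, ← this]
    refine integral_congr_ae ?_
    filter_upwards [coeFn_contToL2 (d ^ n), coeFn_contToL2 d] with θ h1 h2
    rw [h1, h2, pow_succ, ContinuousMap.pow_apply]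

/-- The mean is a continuous functional that is multiplicative on powers of `d`, so it passes
through the exponential series. -/
theorem integral_exp_of_mem_discAlgebra {d : C(UCircle, ℂ)} (hd : d ∈ discAlgebra) :
    ∫ θ, Complex.exp (d θ) ∂circleMeasure = Complex.exp (∫ θ, d θ ∂circleMeasure) := by
  set L : C(UCircle, ℂ) →L[ℂ] ℂ :=
    (innerSL ℂ (fourierLp 2 0 : Lp ℂ 2 circleMeasure)).comp contToL2 with hL
  have hLi : ∀ e : C(UCircle, ℂ), L e = ∫ θ, e θ ∂circleMeasure := fun e => by
    rw [← fourierCoeff_zero_eq_integral, ← fourierCoeff_contToL2, fourierCoeff_eq_inner]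
    rfl
  have h1 := (NormedSpace.exp_series_hasSum_exp' (𝕂 := ℂ) d).mapL L
  have h2 := NormedSpace.exp_series_hasSum_exp' (𝕂 := ℂ) (∫ θ, d θ ∂circleMeasure)
  rw [← Complex.exp_eq_exp_ℂ] at h2
  have h3 : ∀ n : ℕ, L ((n.factorial⁻¹ : ℂ) • d ^ n)
      = (n.factorial⁻¹ : ℂ) • (∫ θ, d θ ∂circleMeasure) ^ n := by
    intro n
    rw [map_smul, hLi, ← integral_pow_of_mem_discAlgebra hd]
    rfl
  simp only [h3] at h1
  rw [← h1.unique h2, hLi]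
  simp only [continuousMap_exp_apply]

theorem analyticCompletion_fourierLp (n : ℤ) :
    ∃ d ∈ discAlgebra, analyticCompletion (fourierLp 2 n) = contToL2 d := by
  have h0 : fourierCoeff (fourierLp 2 n : Lp ℂ 2 circleMeasure) 0 = if 0 = n then 1 else 0 := by
    rw [fourierCoeff_eq_inner, inner_fourierLp]
  rcases lt_or_ge n 0 with hn | hn
  · refine ⟨0, discAlgebra.zero_mem, ?_⟩
    rw [map_zero, analyticCompletion_apply, h0, if_neg hn.ne', zero_smul, sub_zero]
    rw [(Submodule.starProjection_apply_eq_zero_iff _).2, smul_zero]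
    intro g hg
    rw [← inner_conj_symm, ← fourierCoeff_eq_inner, hg n hn, map_zero]
  · have hf : fourierLp 2 n = contToL2 (fourier n) := rfl
    have hm : fourier n ∈ discAlgebra := fourierLp_mem_hardyH2 hn
    refine ⟨(2 : ℂ) • fourier n - (if 0 = n then (1 : ℂ) else 0) • fourier 0, ?_, ?_⟩
    · exact discAlgebra.sub_mem (discAlgebra.smul_mem hm _)
        (discAlgebra.smul_mem (fourierLp_mem_hardyH2 le_rfl) _)
    · rw [analyticCompletion_apply, h0, map_sub, map_smul, map_smul,
        Submodule.starProjection_eq_self_iff.2 (fourierLp_mem_hardyH2 hn)]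

/-- Conjugation does not preserve continuity in general, but it does for trigonometric polynomials;
for these the exponential can be taken inside the disc algebra. -/
theorem analyticCompletion_trigPolynomial {t : C(UCircle, ℂ)}
    (ht : t ∈ Submodule.span ℂ (Set.range fourier)) :
    ∃ d ∈ discAlgebra, analyticCompletion (contToL2 t) = contToL2 d := by
  induction ht using Submodule.span_induction with
  | mem x hx =>
    obtain ⟨n, rfl⟩ := hx
    exact analyticCompletion_fourierLp n
  | zero => exact ⟨0, discAlgebra.zero_mem, by simp⟩
  | add x y _ _ hx hy =>
    obtain ⟨d, hd, h1⟩ := hx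
    obtain ⟨e, he, h2⟩ := hy
    exact ⟨d + e, discAlgebra.add_mem hd he, by simp only [map_add, h1, h2]⟩
  | smul a x _ hx =>
    obtain ⟨d, hd, h1⟩ := hx
    exact ⟨a • d, discAlgebra.smul_mem hd a, by simp only [map_smul, h1]⟩

theorem norm_contToL2_le {d : C(UCircle, ℂ)} {c : ℝ} (hc : 0 ≤ c) (hd : ‖d‖ ≤ c) :
    ‖contToL2 d‖ ≤ c := by
  have h : ∀ᵐ θ ∂circleMeasure, ‖contToL2 d θ‖ ≤ c := by
    filter_upwards [coeFn_contToL2 d] with θ hθ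
    rw [hθ]
    exact (d.norm_coe_le_norm θ).trans hd
  have := Lp.norm_le_of_ae_bound hc h
  simpa [measureUnivNNReal] using this

/-- The uniform bound `M + ε` alongside `L²` closeness is what later provides domination for the
exponentials. -/
theorem exists_trigPolynomial_near {ψ : Lp ℂ 2 circleMeasure} (hψ : AERealValued ψ) {M : ℝ}
    (hM0 : 0 ≤ M) (hM : ∀ᵐ θ ∂circleMeasure, ‖ψ θ‖ ≤ M) {ε : ℝ} (hε : 0 < ε) :
    ∃ t ∈ Submodule.span ℂ (Set.range (fourier (T := 2 * π))),
      (∀ θ, (t θ).im = 0) ∧ (∀ θ, ‖t θ‖ ≤ M + ε) ∧ ‖contToL2 t - ψ‖ ≤ ε := by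
  obtain ⟨g, hg⟩ := (ContinuousMap.toLp_denseRange (p := 2) ℂ circleMeasure ℂ
    ENNReal.ofNat_ne_top).exists_dist_lt ψ (half_pos hε)
  -- Taking the real part and truncating to `[-M, M]` is 1-Lipschitz and fixes the values of `ψ`, so
  -- the distance to `ψ` does not grow.
  set φ : C(UCircle, ℂ) := ⟨fun θ => ((max (-M) (min (g θ).re M) : ℝ) : ℂ), by fun_prop⟩ with hφ
  have hφa : ∀ θ, φ θ = ((max (-M) (min (g θ).re M) : ℝ) : ℂ) := fun θ => rfl
  have hφψ : ‖contToL2 φ - ψ‖ ≤ ε / 2 := by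
    rw [dist_comm, dist_eq_norm] at hg
    refine le_trans (Lp.norm_le_norm_of_ae_le ?_) hg.le
    filter_upwards [Lp.coeFn_sub (contToL2 φ) ψ, Lp.coeFn_sub (contToL2 g) ψ, coeFn_contToL2 φ,
      coeFn_contToL2 g, hψ, hM] with θ h1 h2 h3 h4 h5 h6
    rw [h1, h2, Pi.sub_apply, Pi.sub_apply, h3, h4, hφa]
    have hψr : ψ θ = ((ψ θ).re : ℂ) := Complex.ext rfl (by simpa using h5)
    have h7 : |(ψ θ).re| ≤ M := (Complex.abs_re_le_norm _).trans h6
    refine le_trans ?_ (Complex.abs_re_le_norm _)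
    rw [hψr, ← Complex.ofReal_sub, Complex.norm_real, Real.norm_eq_abs, Complex.sub_re,
      Complex.ofReal_re]
    have h8 := abs_le.1 h7
    have : (ψ θ).re = max (-M) (min (ψ θ).re M) := by
      rw [min_eq_left h8.2, max_eq_right h8.1]
    conv_lhs => rw [this]
    refine (abs_max_sub_max_le_max _ _ _ _).trans ?_
    rw [sub_self, abs_zero, max_eq_right (abs_nonneg _)]
    refine (abs_min_sub_min_le_max _ _ _ _).trans ?_
    rw [sub_self, abs_zero, max_eq_left (abs_nonneg _)]
  have hmem : φ ∈ (fourierSubalgebra (T := 2 * π)).topologicalClosure := by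
    rw [fourierSubalgebra_closure_eq_top]
    trivial
  obtain ⟨t, ht, htφ⟩ := Metric.mem_closure_iff.1 hmem (ε / 2) (half_pos hε)
  have hφs : star φ = φ := by
    ext θ
    rw [ContinuousMap.star_apply, hφa, RCLike.star_def, Complex.conj_ofReal]
  rw [dist_comm, dist_eq_norm] at htφ
  -- The real part of a trigonometric polynomial is again one, and is no farther from the real
  -- function `φ`.
  set t' : C(UCircle, ℂ) := (1 / 2 : ℂ) • (t + star t) with ht'
  have htφ' : ‖t' - φ‖ ≤ ε / 2 := by
    have h1 : t' - φ = (1 / 2 : ℂ) • ((t - φ) + star (t - φ)) := by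
      rw [star_sub, hφs, ht', show t - φ + (star t - φ) = (t + star t) - (2 : ℂ) • φ by
        rw [two_smul]; abel, smul_sub, smul_smul]
      norm_num
    rw [h1, norm_smul]
    have h2 := norm_add_le (t - φ) (star (t - φ))
    rw [norm_star] at h2
    rw [show ‖(1 / 2 : ℂ)‖ = 1 / 2 by norm_num]
    linarith
  refine ⟨t', ?_, ?_, ?_, ?_⟩
  · rw [← fourierSubalgebra_coe]
    exact Submodule.smul_mem _ _ (Submodule.add_mem _ ht
      (star_mem (s := fourierSubalgebra (T := 2 * π)) ht))
  · intro θ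
    simp [ht']
  · intro θ
    have h1 : ‖φ θ‖ ≤ M := by
      rw [hφa, Complex.norm_real, Real.norm_eq_abs, abs_le]
      exact ⟨le_max_left _ _, max_le (by linarith) (min_le_right _ _)⟩
    have h2 : ‖t' θ - φ θ‖ ≤ ε / 2 := (((t' - φ).norm_coe_le_norm θ)).trans htφ'
    have h3 := norm_le_norm_add_norm_sub' (t' θ) (φ θ)
    linarith
  · have h1 : ‖contToL2 t' - contToL2 φ‖ ≤ ε / 2 := by
      rw [← map_sub]
      exact norm_contToL2_le (half_pos hε).le htφ'
    have h2 := norm_sub_le_norm_sub_add_norm_sub (contToL2 t') (contToL2 φ) ψ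
    linarith

/-- For a bounded real function `ψ`, the function `exp (ψ + i ψ̃)` belongs to the Hardy space. -/
theorem exists_exp_analyticCompletion {ψ : Lp ℂ 2 circleMeasure} (hψ : AERealValued ψ) {M : ℝ}
    (hM : ∀ᵐ θ ∂circleMeasure, ‖ψ θ‖ ≤ M) :
    ∃ m ∈ hardyH2, m =ᵐ[circleMeasure] (fun θ => Complex.exp (analyticCompletion ψ θ)) ∧
      fourierCoeff m 0 = Complex.exp (fourierCoeff ψ 0) := by
  have hM0 : 0 ≤ M := by
    obtain ⟨θ, hθ⟩ := hM.exists
    exact (norm_nonneg _).trans hθ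
  have hb : ∀ᵐ θ ∂circleMeasure, ‖Complex.exp (analyticCompletion ψ θ)‖ ≤ Real.exp M := by
    filter_upwards [hM, re_analyticCompletion hψ] with θ h1 h2
    rw [Complex.norm_exp, h2, Real.exp_le_exp]
    exact (Complex.re_le_norm _).trans h1
  have hmem : MemLp (fun θ => Complex.exp (analyticCompletion ψ θ)) 2 circleMeasure :=
    MemLp.of_bound (Complex.continuous_exp.comp_aestronglyMeasurable
      (Lp.aestronglyMeasurable _)) _ hb
  choose t ht him hbd hdist using fun k : ℕ =>
    exists_trigPolynomial_near hψ hM0 hM (ε := 1 / ((k : ℝ) + 1)) (by positivity)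
  choose d hdD hd using fun k => analyticCompletion_trigPolynomial (ht k)
  have htend : Tendsto (fun k => contToL2 (t k)) atTop (𝓝 ψ) := by
    rw [tendsto_iff_norm_sub_tendsto_zero]
    exact squeeze_zero (fun _ => norm_nonneg _) hdist tendsto_one_div_add_atTop_nhds_zero_nat
  have hdt : Tendsto (fun k => contToL2 (d k)) atTop (𝓝 (analyticCompletion ψ)) := by
    simp only [← hd]
    exact (analyticCompletion.continuous.tendsto ψ).comp htend
  obtain ⟨ns, hns, hae⟩ := (tendstoInMeasure_of_tendsto_Lp hdt).exists_seq_tendsto_ae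
  have hcoe : ∀ᵐ θ ∂circleMeasure, ∀ k, contToL2 (d k) θ = d k θ :=
    ae_all_iff.2 fun k => coeFn_contToL2 (d k)
  have hre : ∀ᵐ θ ∂circleMeasure, ∀ k, (d k θ).re ≤ M + 1 := by
    rw [ae_all_iff]
    intro k
    have hr : AERealValued (contToL2 (t k)) := by
      filter_upwards [coeFn_contToL2 (t k)] with θ hθ
      rw [hθ, him]
    filter_upwards [re_analyticCompletion hr, coeFn_contToL2 (d k), coeFn_contToL2 (t k)]
      with θ h1 h2 h3
    rw [hd, h2, h3] at h1
    rw [h1]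
    refine (Complex.re_le_norm _).trans ((hbd k θ).trans ?_)
    have : 1 / ((k : ℝ) + 1) ≤ 1 := by
      rw [div_le_one (by positivity)]
      linarith [(Nat.cast_nonneg k : (0 : ℝ) ≤ k)]
    linarith
  -- Dominated convergence: `|exp (d k)| = exp (Re (d k)) ≤ exp (M + 1)`, with no control of the
  -- conjugate functions needed.
  have hlim : ∀ n : ℤ, Tendsto (fun k => fourierCoeff (NormedSpace.exp (d (ns k)) : C(UCircle, ℂ)) n) atTop
      (𝓝 (fourierCoeff (fun θ => Complex.exp (analyticCompletion ψ θ)) n)) := by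
    intro n
    refine tendsto_integral_of_dominated_convergence (fun _ => Real.exp (M + 1)) ?_
      (integrable_const _) ?_ ?_
    · exact fun k => (((fourier (-n)).continuous.smul
        (NormedSpace.exp (d (ns k)) : C(UCircle, ℂ)).continuous)).aestronglyMeasurable
    · intro k
      filter_upwards [hre] with θ h1
      rw [norm_smul, fourier_apply, Circle.norm_coe, one_mul, continuousMap_exp_apply,
        Complex.norm_exp, Real.exp_le_exp]
      exact h1 _
    · filter_upwards [hae, hcoe] with θ h1 h2
      simp only [h2, continuousMap_exp_apply] at h1 ⊢
      exact ((Complex.continuous_exp.tendsto _).comp h1).const_smul _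
  have hcoeff : ∀ n, fourierCoeff (hmem.toLp _) n
      = fourierCoeff (fun θ => Complex.exp (analyticCompletion ψ θ)) n :=
    fun n => congrFun (fourierCoeff_congr_ae hmem.coeFn_toLp) n
  refine ⟨hmem.toLp _, ?_, hmem.coeFn_toLp, ?_⟩
  · intro n hn
    rw [hcoeff]
    refine tendsto_nhds_unique (hlim n) ?_
    have : ∀ k, fourierCoeff (NormedSpace.exp (d (ns k)) : C(UCircle, ℂ)) n = 0 := fun k => by
      rw [← fourierCoeff_contToL2]
      exact exp_mem_discAlgebra (hdD _) n hn
    simp only [this]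
    exact tendsto_const_nhds
  · rw [hcoeff]
    refine tendsto_nhds_unique (hlim 0) ?_
    have h1 : ∀ k, fourierCoeff (NormedSpace.exp (d (ns k)) : C(UCircle, ℂ)) 0
        = Complex.exp (fourierCoeff (contToL2 (d (ns k))) 0) := fun k => by
      rw [fourierCoeff_contToL2, fourierCoeff_zero_eq_integral, fourierCoeff_zero_eq_integral,
        ← integral_exp_of_mem_discAlgebra (hdD _)]
      simp only [continuousMap_exp_apply]
    simp only [h1]
    refine (Complex.continuous_exp.tendsto _).comp ?_
    rw [← fourierCoeff_analyticCompletion_zero]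
    simp only [fourierCoeff_eq_inner]
    exact tendsto_const_nhds.inner (hdt.comp hns.tendsto_atTop)

/-! ### Uniqueness: functions of the Hardy space vanishing on a set of positive measure -/

theorem exists_Lp_of_bounded_real {r : UCircle → ℝ} (hr : Measurable r) {C : ℝ}
    (hC : ∀ θ, |r θ| ≤ C) :
    ∃ ψ : Lp ℂ 2 circleMeasure, ψ =ᵐ[circleMeasure] (fun θ => (r θ : ℂ)) ∧ AERealValued ψ ∧
      ∀ᵐ θ ∂circleMeasure, ‖ψ θ‖ ≤ C := by
  have hm : MemLp (fun θ => (r θ : ℂ)) 2 circleMeasure :=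
    MemLp.of_bound (Complex.measurable_ofReal.comp hr).aestronglyMeasurable C
      (ae_of_all _ fun θ => by simpa using hC θ)
  refine ⟨hm.toLp _, hm.coeFn_toLp, ?_, ?_⟩
  · filter_upwards [hm.coeFn_toLp] with θ hθ
    rw [hθ, Complex.ofReal_im]
  · filter_upwards [hm.coeFn_toLp] with θ hθ
    rw [hθ]
    simpa using hC θ

/-- Multiplying `g` by `exp (ψ + i ψ̃)` with `ψ` of mean zero keeps its mean. Taking `ψ = -n` off
`E` makes the product at most `e^{-n} |g|`, since the large values on `E` meet the zeros of `g`. -/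
theorem integral_eq_zero_of_vanishes {g : Lp ℂ 2 circleMeasure} (hg : g ∈ hardyH2)
    {E : Set UCircle} (hE : MeasurableSet E) (hE0 : circleMeasure E ≠ 0)
    (hgE : ∀ᵐ θ ∂circleMeasure, θ ∈ E → g θ = 0) : fourierCoeff g 0 = 0 := by
  classical
  have hpos : 0 < circleMeasure.real E := ENNReal.toReal_pos hE0 (measure_ne_top _ _)
  have hbound : ∀ n : ℕ, ‖fourierCoeff g 0‖ ≤ Real.exp (-n) * ∫ θ, ‖g θ‖ ∂circleMeasure := by
    intro n
    -- The value on `E` that compensates `-n` off `E`, so that `ψ` has mean zero.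
    set S : ℝ := n * circleMeasure.real Eᶜ / circleMeasure.real E with hS
    have hS0 : 0 ≤ S := by positivity
    have hr : Measurable (E.piecewise (fun _ => S) (fun _ => -(n : ℝ))) :=
      measurable_const.piecewise hE measurable_const
    obtain ⟨ψ, hψ, hψr, hψb⟩ := exists_Lp_of_bounded_real hr (C := S + n) (fun θ => by
      by_cases h : θ ∈ E
      · rw [Set.piecewise_eq_of_mem _ _ _ h, abs_of_nonneg hS0]
        linarith [(Nat.cast_nonneg n : (0 : ℝ) ≤ n)]
      · rw [Set.piecewise_eq_of_notMem _ _ _ h, abs_neg, Nat.abs_cast]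
        linarith)
    obtain ⟨m, hm, hme, hm0⟩ := exists_exp_analyticCompletion hψr hψb
    have hψ0 : fourierCoeff ψ 0 = 0 := by
      rw [fourierCoeff_zero_eq_integral, integral_congr_ae hψ, integral_complex_ofReal,
        integral_piecewise hE (integrable_const _).integrableOn (integrable_const _).integrableOn,
        setIntegral_const, setIntegral_const, smul_eq_mul, smul_eq_mul, hS,
        Complex.ofReal_eq_zero]
      field_simp
      ring
    have hint := integral_mul_of_mem_hardyH2 hg hm
    rw [hm0, hψ0, Complex.exp_zero, mul_one] at hint
    rw [← hint, ← integral_const_mul]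
    refine norm_integral_le_of_norm_le
      (((Lp.memLp g).integrable one_le_two).norm.const_mul _) ?_
    filter_upwards [hgE, hme, hψ, re_analyticCompletion hψr] with θ h1 h2 h3 h4
    by_cases h : θ ∈ E
    · rw [h1 h]
      simp
    · rw [norm_mul, h2, Complex.norm_exp, h4, h3, Complex.ofReal_re,
        Set.piecewise_eq_of_notMem _ _ _ h, mul_comm]
  have hlim : Tendsto (fun n : ℕ => Real.exp (-n) * ∫ θ, ‖g θ‖ ∂circleMeasure) atTop (𝓝 0) := by
    have := (Real.tendsto_exp_neg_atTop_nhds_zero.comp tendsto_natCast_atTop_atTop).mul_const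
      (∫ θ, ‖g θ‖ ∂circleMeasure)
    rw [zero_mul] at this
    exact this
  exact norm_le_zero_iff.1 (ge_of_tendsto' hlim hbound)

/-- A function of the Hardy space which vanishes on a set of positive measure is zero. -/
theorem eq_zero_of_vanishes {g : Lp ℂ 2 circleMeasure} (hg : g ∈ hardyH2)
    {E : Set UCircle} (hE : MeasurableSet E) (hE0 : circleMeasure E ≠ 0)
    (hgE : ∀ᵐ θ ∂circleMeasure, θ ∈ E → g θ = 0) : g = 0 := by
  have hnat : ∀ n : ℕ, fourierCoeff g n = 0 := by
    intro n
    induction n using Nat.strong_induction_on with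
    | _ n ih =>
      -- Once the coefficients below `n` vanish, `e^{-inθ} g` is still in `H²`, and its mean is the
      -- `n`-th coefficient of `g`.
      obtain ⟨h, hh, hc⟩ := exists_fourier_mul g (-n)
      have hH : h ∈ hardyH2 := by
        intro m hm
        rw [hc]
        rcases lt_or_ge (m - -(n : ℤ)) 0 with h1 | h1
        · exact hg _ h1
        · obtain ⟨k, hk⟩ := Int.eq_ofNat_of_zero_le h1
          rw [hk]
          exact ih k (by omega)
      have := integral_eq_zero_of_vanishes hH hE hE0 (by
        filter_upwards [hh, hgE] with θ h1 h2 h3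
        rw [h1, h2 h3, mul_zero])
      rw [hc] at this
      simpa using this
  apply ext_fourierCoeff
  intro n
  rw [fourierCoeff_eq_inner 0, inner_zero_right]
  rcases lt_or_ge n 0 with h | h
  · exact hg n h
  · obtain ⟨k, rfl⟩ := Int.eq_ofNat_of_zero_le h
    exact hnat k

/-! ### Density of conjugate functions -/

/-- The restriction map from `L²` of the circle to `L²(I)`. -/
noncomputable abbrev restrictTo (I : Set UCircle) :
    Lp ℂ 2 circleMeasure →L[ℂ] Lp ℂ 2 (circleMeasure.restrict I) :=
  LpToLpRestrictCLM UCircle ℂ ℂ circleMeasure 2 I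

theorem coeFn_restrictTo (I : Set UCircle) (g : Lp ℂ 2 circleMeasure) :
    restrictTo I g =ᵐ[circleMeasure.restrict I] g :=
  LpToLpRestrictCLM_coeFn ℂ I g

/-- The bounded real functions supported in `E`. -/
def boundedRealOn (E : Set UCircle) : Submodule ℝ (Lp ℂ 2 circleMeasure) where
  carrier := {ψ | AERealValued ψ ∧ (∃ C : ℝ, ∀ᵐ θ ∂circleMeasure, ‖ψ θ‖ ≤ C) ∧
    ∀ᵐ θ ∂circleMeasure, θ ∉ E → ψ θ = 0}
  add_mem' := by
    rintro a b ⟨h1, ⟨C, h2⟩, h3⟩ ⟨k1, ⟨D, k2⟩, k3⟩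
    refine ⟨?_, ⟨C + D, ?_⟩, ?_⟩
    · filter_upwards [h1, k1, Lp.coeFn_add a b] with θ p q r
      rw [r, Pi.add_apply, Complex.add_im, p, q, add_zero]
    · filter_upwards [h2, k2, Lp.coeFn_add a b] with θ p q r
      rw [r, Pi.add_apply]
      exact (norm_add_le _ _).trans (add_le_add p q)
    · filter_upwards [h3, k3, Lp.coeFn_add a b] with θ p q r h
      rw [r, Pi.add_apply, p h, q h, add_zero]
  zero_mem' := by
    refine ⟨?_, ⟨0, ?_⟩, ?_⟩ <;> filter_upwards [Lp.coeFn_zero ℂ 2 circleMeasure] with θ h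
    · rw [h, Pi.zero_apply, Complex.zero_im]
    · rw [h, Pi.zero_apply, norm_zero]
    · exact fun _ => h
  smul_mem' := by
    rintro c a ⟨h1, ⟨C, h2⟩, h3⟩
    refine ⟨?_, ⟨|c| * C, ?_⟩, ?_⟩
    · filter_upwards [h1, Lp.coeFn_smul c a] with θ p r
      rw [r, Pi.smul_apply, Complex.smul_im, p, smul_zero]
    · filter_upwards [h2, Lp.coeFn_smul c a] with θ p r
      rw [r, Pi.smul_apply, norm_smul, Real.norm_eq_abs]
      gcongr
    · filter_upwards [h3, Lp.coeFn_smul c a] with θ p r h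
      rw [r, Pi.smul_apply, p h, smul_zero]

theorem integral_im_eq_zero_of_real {a : Lp ℂ 2 circleMeasure} (ha : AERealValued a) :
    (fourierCoeff a 0).im = 0 := by
  have := fourierCoeff_star a 0
  rw [ha.star_eq, neg_zero] at this
  exact Complex.conj_eq_iff_im.1 this.symm

theorem inner_real_eq_re_mul_add_im_mul (z w : ℂ) : inner ℝ z w = z.re * w.re + z.im * w.im := by
  rw [Complex.inner]
  simp [mul_comm]

/-- The conjugation operator is skew-symmetric. -/
theorem integral_im_analyticCompletion_mul {a ψ : Lp ℂ 2 circleMeasure} (ha : AERealValued a)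
    (hψ : AERealValued ψ) :
    ∫ θ, (ψ θ).re * (analyticCompletion a θ).im ∂circleMeasure =
      - ∫ θ, (a θ).re * (analyticCompletion ψ θ).im ∂circleMeasure := by
  -- The mean of `(a + i ã)(ψ + i ψ̃)` is a product of two real numbers; its imaginary part is the
  -- mean of `a ψ̃ + ψ ã`.
  have h1 := integral_mul_of_mem_hardyH2 (analyticCompletion_mem a) (analyticCompletion_mem ψ)
  rw [fourierCoeff_analyticCompletion_zero, fourierCoeff_analyticCompletion_zero] at h1
  have h2 := congrArg Complex.im h1
  rw [Complex.mul_im, integral_im_eq_zero_of_real ha, integral_im_eq_zero_of_real hψ, mul_zero,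
    zero_mul, add_zero] at h2
  have hr : ∀ g h : Lp ℂ 2 circleMeasure,
      Integrable (fun θ => (g θ).re * (h θ).im) circleMeasure := fun g h =>
    (Lp.memLp g).re.integrable_mul (Lp.memLp h).im
  have h3 : (∫ θ, analyticCompletion a θ * analyticCompletion ψ θ ∂circleMeasure).im =
      ∫ θ, (analyticCompletion a θ * analyticCompletion ψ θ).im ∂circleMeasure :=
    (integral_im (integrable_mul_of_Lp (analyticCompletion a) (analyticCompletion ψ))).symm
  rw [h3] at h2
  rw [eq_neg_iff_add_eq_zero, ← integral_add (hr _ _) (hr _ _), ← h2]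
  refine integral_congr_ae ?_
  filter_upwards [re_analyticCompletion ha, re_analyticCompletion hψ] with θ p q
  rw [Complex.mul_im, p, q]
  ring

/-- If `E` has positive measure and is disjoint from `I`, then the conjugate functions of
bounded real functions supported in `E` are dense in the real `L²(I)`. -/
theorem mem_closure_analyticCompletion {I E : Set UCircle} (hI : MeasurableSet I)
    (hE : MeasurableSet E) (hIE : Disjoint I E) (hE0 : circleMeasure E ≠ 0)
    {τ : Lp ℂ 2 (circleMeasure.restrict I)}
    (hτ : ∀ᵐ θ ∂circleMeasure.restrict I, (τ θ).re = 0) :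
    τ ∈ ((boundedRealOn E).map
      (((restrictTo I).comp analyticCompletion).restrictScalars ℝ).toLinearMap).topologicalClosure := by
  rw [← Submodule.orthogonal_orthogonal_eq_closure, Submodule.mem_orthogonal]
  intro y hy
  rw [Submodule.mem_orthogonal] at hy
  suffices hyim : ∀ᵐ θ ∂circleMeasure.restrict I, (y θ).im = 0 by
    rw [L2.inner_def]
    refine integral_eq_zero_of_ae ?_
    filter_upwards [hyim, hτ] with θ h1 h2
    rw [inner_real_eq_re_mul_add_im_mul, h1, h2]
    simp
  have hmem : MemLp (I.indicator fun θ => ((y θ).im : ℂ)) 2 circleMeasure := by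
    rw [memLp_indicator_iff_restrict hI]
    exact (Lp.memLp y).im.ofReal
  -- `Im y` on `I`, extended by zero; it vanishes on `E`.
  set a : Lp ℂ 2 circleMeasure := hmem.toLp _ with ha_def
  have hae : a =ᵐ[circleMeasure] I.indicator fun θ => ((y θ).im : ℂ) := hmem.coeFn_toLp
  have ha : AERealValued a := by
    filter_upwards [hae] with θ h
    rw [h]
    by_cases hθ : θ ∈ I <;> simp [hθ]
  have horth : ∀ ψ ∈ boundedRealOn E,
      ∫ θ, (a θ).re * (analyticCompletion ψ θ).im ∂circleMeasure = 0 := by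
    intro ψ hψ
    have h1 := hy _ (Submodule.mem_map_of_mem hψ)
    rw [L2.inner_def] at h1
    rw [← h1, ← integral_indicator hI]
    refine integral_congr_ae ?_
    have h2 := (ae_restrict_iff' hI).1 (coeFn_restrictTo I (analyticCompletion ψ))
    filter_upwards [h2, re_analyticCompletion hψ.1, hψ.2.2, hae] with θ p q r s
    rw [s]
    by_cases hθ : θ ∈ I
    · have hψ0 : ψ θ = 0 := r (Set.disjoint_left.1 hIE hθ)
      have p' : (((((restrictTo I).comp analyticCompletion).restrictScalars ℝ).toLinearMap ψ :
          Lp ℂ 2 (circleMeasure.restrict I)) : UCircle → ℂ) θ = analyticCompletion ψ θ := p hθ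
      rw [Set.indicator_of_mem hθ, Set.indicator_of_mem hθ, p', inner_real_eq_re_mul_add_im_mul, q, hψ0,
        Complex.ofReal_re, Complex.zero_re, zero_mul, zero_add, mul_comm]
    · rw [Set.indicator_of_notMem hθ, Set.indicator_of_notMem hθ, Complex.zero_re, zero_mul]
  have him : ∀ᵐ θ ∂circleMeasure, θ ∈ E → (analyticCompletion a θ).im = 0 := by
    have hmeas : Measurable fun θ => (analyticCompletion a θ).im :=
      Complex.measurable_im.comp (Lp.stronglyMeasurable _).measurable
    -- Testing against the sign of `ã` on `E` turns the orthogonality into `∫_E |ã| = 0`.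
    have hsm : Measurable
        (E.indicator fun θ => if 0 ≤ (analyticCompletion a θ).im then (1 : ℝ) else -1) :=
      (Measurable.ite (measurableSet_le measurable_const hmeas) measurable_const
        measurable_const).indicator hE
    obtain ⟨ψ, hψ, hψr, hψb⟩ := exists_Lp_of_bounded_real hsm (C := 1) (fun θ => by
      by_cases h : θ ∈ E
      · rw [Set.indicator_of_mem h]
        split_ifs <;> simp
      · rw [Set.indicator_of_notMem h]
        simp)
    have hψE : ψ ∈ boundedRealOn E := by
      refine ⟨hψr, ⟨1, hψb⟩, ?_⟩
      filter_upwards [hψ] with θ h h'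
      rw [h, Set.indicator_of_notMem h', Complex.ofReal_zero]
    have h1 := integral_im_analyticCompletion_mul ha hψr
    rw [horth ψ hψE, neg_zero] at h1
    have h2 : (fun θ => (ψ θ).re * (analyticCompletion a θ).im) =ᵐ[circleMeasure]
        E.indicator fun θ => |(analyticCompletion a θ).im| := by
      filter_upwards [hψ] with θ h
      rw [h, Complex.ofReal_re]
      by_cases hθ : θ ∈ E
      · rw [Set.indicator_of_mem hθ, Set.indicator_of_mem hθ]
        split_ifs with h0
        · rw [one_mul, abs_of_nonneg h0]
        · rw [neg_one_mul, abs_of_neg (not_le.1 h0)]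
      · rw [Set.indicator_of_notMem hθ, Set.indicator_of_notMem hθ, zero_mul]
    have h3 : Integrable (fun θ => (analyticCompletion a θ).im) circleMeasure :=
      ((Lp.memLp (analyticCompletion a)).integrable one_le_two).im
    rw [integral_congr_ae h2, integral_eq_zero_iff_of_nonneg
      (fun θ => Set.indicator_nonneg (fun _ _ => abs_nonneg _) θ) (h3.abs.indicator hE)] at h1
    filter_upwards [h1] with θ h hθ
    rw [Set.indicator_of_mem hθ] at h
    exact abs_eq_zero.1 h
  have hA : analyticCompletion a = 0 := by
    refine eq_zero_of_vanishes (analyticCompletion_mem a) hE hE0 ?_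
    filter_upwards [him, re_analyticCompletion ha, hae] with θ h1 h2 h3 hθ
    refine Complex.ext ?_ (h1 hθ)
    rw [h2, h3, Set.indicator_of_notMem (Set.disjoint_right.1 hIE hθ)]
  rw [ae_restrict_iff' hI]
  have h0 := re_analyticCompletion ha
  rw [hA] at h0
  filter_upwards [h0, hae, Lp.coeFn_zero ℂ 2 circleMeasure] with θ h1 h2 h3 hθ
  rw [h3, h2, Set.indicator_of_mem hθ, Complex.ofReal_re] at h1
  exact h1.symm

/-- Unimodular functions on `I` are boundedly approximated almost everywhere on `I` by bounded
functions of the Hardy space which are as small as desired off `I` and off a set `E` of positive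
measure. -/
theorem exists_hardyH2_seq_tendsto {I E : Set UCircle} (hI : MeasurableSet I)
    (hE : MeasurableSet E) (hIE : Disjoint I E) (hE0 : circleMeasure E ≠ 0)
    {β : UCircle → ℝ} (hβ : Measurable β) {B : ℝ} (hB : ∀ θ, |β θ| ≤ B) {T : ℝ} (hT : 0 ≤ T) :
    ∃ m : ℕ → Lp ℂ 2 circleMeasure, (∀ j, m j ∈ hardyH2) ∧
      (∀ j, ∃ C : ℝ, ∀ᵐ θ ∂circleMeasure, ‖m j θ‖ ≤ C) ∧
      (∀ j, ∀ᵐ θ ∂circleMeasure, θ ∈ I → ‖m j θ‖ = 1) ∧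
      (∀ j, ∀ᵐ θ ∂circleMeasure, θ ∉ I → θ ∉ E → ‖m j θ‖ = Real.exp (-T)) ∧
      ∀ᵐ θ ∂circleMeasure.restrict I,
        Tendsto (fun j => m j θ) atTop (𝓝 (Complex.exp (β θ * Complex.I))) := by
  classical
  -- This base function fixes the moduli: `1` on `I` and `e^{-T}` off `I ∪ E`. Corrections supported
  -- in `E` then adjust the phase on `I` without changing either.
  have hr : Measurable ((I ∪ E)ᶜ.indicator fun _ => -T) :=
    measurable_const.indicator (hI.union hE).compl
  have hr0 : ∀ θ, θ ∈ I ∪ E → ((I ∪ E)ᶜ.indicator fun _ => -T) θ = 0 := by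
    intro θ hθ
    exact Set.indicator_of_notMem (Set.notMem_compl_iff.2 hθ) _
  have hr1 : ∀ θ, θ ∉ I ∪ E → ((I ∪ E)ᶜ.indicator fun _ => -T) θ = -T := by
    intro θ hθ
    exact Set.indicator_of_mem hθ _
  obtain ⟨χ, hχ, hχr, hχb⟩ := exists_Lp_of_bounded_real hr (C := T) (fun θ => by
    by_cases h : θ ∈ I ∪ E
    · rw [hr0 θ h, abs_zero]
      exact hT
    · rw [hr1 θ h, abs_neg, abs_of_nonneg hT])
  have hτm : MemLp (fun θ => (β θ : ℂ) * Complex.I) 2 (circleMeasure.restrict I) :=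
    MemLp.of_bound ((Complex.measurable_ofReal.comp hβ).mul_const _).aestronglyMeasurable B
      (ae_of_all _ fun θ => by simpa using hB θ)
  -- The phase still missing on `I`, purely imaginary there because `χ` vanishes on `I`.
  set τ := hτm.toLp _ - restrictTo I (analyticCompletion χ) with hτ
  have hτre : ∀ᵐ θ ∂circleMeasure.restrict I, (τ θ).re = 0 := by
    filter_upwards [Lp.coeFn_sub (hτm.toLp _) (restrictTo I (analyticCompletion χ)),
      hτm.coeFn_toLp, coeFn_restrictTo I (analyticCompletion χ),
      ae_restrict_of_ae (re_analyticCompletion hχr), ae_restrict_of_ae hχ, ae_restrict_mem hI]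
      with θ h1 h2 h3 h4 h5 h6
    rw [h1, Pi.sub_apply, h2, h3, Complex.sub_re, h4, h5, hr0 θ (Or.inl h6)]
    simp
  have hcl := mem_closure_analyticCompletion hI hE hIE hE0 hτre
  obtain ⟨x, hx, hxτ⟩ := mem_closure_iff_seq_limit.1 hcl
  choose ψ hψ hψx using hx
  have hlim : Tendsto (fun j => restrictTo I (analyticCompletion (χ + ψ j))) atTop
      (𝓝 (hτm.toLp _)) := by
    have h1 : ∀ j, restrictTo I (analyticCompletion (χ + ψ j))
        = restrictTo I (analyticCompletion χ) + x j := by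
      intro j
      rw [map_add, map_add, ← hψx]
      rfl
    simp only [h1]
    have := hxτ.const_add (restrictTo I (analyticCompletion χ))
    rwa [hτ, add_sub_cancel] at this
  obtain ⟨ns, hns, hae⟩ := (tendstoInMeasure_of_tendsto_Lp hlim).exists_seq_tendsto_ae
  have hreal : ∀ j, AERealValued (χ + ψ j) := by
    intro j
    filter_upwards [hχr, (hψ j).1, Lp.coeFn_add χ (ψ j)] with θ h1 h2 h3
    rw [h3, Pi.add_apply, Complex.add_im, h1, h2, add_zero]
  have hbdd : ∀ j, ∃ C : ℝ, ∀ᵐ θ ∂circleMeasure, ‖(χ + ψ j) θ‖ ≤ C := by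
    intro j
    obtain ⟨C, hC⟩ := (hψ j).2.1
    refine ⟨T + C, ?_⟩
    filter_upwards [hχb, hC, Lp.coeFn_add χ (ψ j)] with θ h1 h2 h3
    rw [h3, Pi.add_apply]
    exact (norm_add_le _ _).trans (add_le_add h1 h2)
  choose C hC using hbdd
  choose m hmH hme hm0 using fun j => exists_exp_analyticCompletion (hreal j) (hC j)
  have hnorm : ∀ j, ∀ᵐ θ ∂circleMeasure, ‖m j θ‖ = Real.exp ((χ + ψ j) θ).re := by
    intro j
    filter_upwards [hme j, re_analyticCompletion (hreal j)] with θ h1 h2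
    rw [h1, Complex.norm_exp, h2]
  have hval : ∀ j, ∀ᵐ θ ∂circleMeasure, θ ∉ E → ‖m j θ‖
      = Real.exp (((I ∪ E)ᶜ.indicator fun _ => -T) θ) := by
    intro j
    filter_upwards [hnorm j, Lp.coeFn_add χ (ψ j), hχ, (hψ j).2.2] with θ h1 h2 h3 h4 h5
    rw [h1, h2, Pi.add_apply, h4 h5, add_zero, h3, Complex.ofReal_re]
  refine ⟨fun j => m (ns j), fun j => hmH _, fun j => ⟨Real.exp (C (ns j)), ?_⟩, fun j => ?_,
    fun j => ?_, ?_⟩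
  · filter_upwards [hnorm (ns j), hC (ns j)] with θ h1 h2
    rw [h1, Real.exp_le_exp]
    exact (Complex.re_le_norm _).trans h2
  · filter_upwards [hval (ns j)] with θ h1 h2
    rw [h1 (Set.disjoint_left.1 hIE h2), hr0 θ (Or.inl h2), Real.exp_zero]
  · filter_upwards [hval (ns j)] with θ h1 h2 h3
    rw [h1 h3, hr1 θ (fun h => h.elim h2 h3)]
  · have h1 : ∀ᵐ θ ∂circleMeasure.restrict I, ∀ j,
        m j θ = Complex.exp (analyticCompletion (χ + ψ j) θ) :=
      ae_all_iff.2 fun j => ae_restrict_of_ae (hme j)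
    have h2 : ∀ᵐ θ ∂circleMeasure.restrict I, ∀ j,
        restrictTo I (analyticCompletion (χ + ψ j)) θ = analyticCompletion (χ + ψ j) θ :=
      ae_all_iff.2 fun j => coeFn_restrictTo I _
    filter_upwards [h1, h2, hae, hτm.coeFn_toLp] with θ p q r s
    simp only [q, s] at r
    simp only [p]
    exact (Complex.continuous_exp.tendsto _).comp r

/-- An integrable function on `I` whose pairing with bounded functions of the Hardy space
is controlled by their supremum away from `I` and from a set of positive measure vanishes. -/
theorem ae_eq_zero_of_pairing_le {I E : Set UCircle} (hI : MeasurableSet I)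
    (hE : MeasurableSet E) (hIE : Disjoint I E) (hE0 : circleMeasure E ≠ 0)
    {κ : UCircle → ℂ} (hκm : Measurable κ) (hκ : IntegrableOn κ I circleMeasure) {c : ℝ}
    (H : ∀ m ∈ hardyH2, ∀ C η : ℝ, 0 ≤ η → (∀ᵐ θ ∂circleMeasure, ‖m θ‖ ≤ C) →
      (∀ᵐ θ ∂circleMeasure, θ ∉ I → θ ∉ E → ‖m θ‖ ≤ η) →
      (∫ θ in I, κ θ * m θ ∂circleMeasure).re ≤ c * η) :
    ∀ᵐ θ ∂circleMeasure.restrict I, κ θ = 0 := by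
  -- With limiting phase `-arg κ` on `I`, the pairing tends to `∫_I |κ|`.
  have hβ : Measurable fun θ => -(κ θ).arg := (Complex.measurable_arg.comp hκm).neg
  have key : ∀ n : ℕ, ∫ θ in I, ‖κ θ‖ ∂circleMeasure ≤ c * Real.exp (-n) := by
    intro n
    obtain ⟨m, hmH, hmb, hmI, hmJ, hlim⟩ := exists_hardyH2_seq_tendsto hI hE hIE hE0 hβ
      (B := π) (fun θ => by rw [abs_neg]; exact Complex.abs_arg_le_pi _) (Nat.cast_nonneg n)
    have h1 : ∀ j, (∫ θ in I, κ θ * m j θ ∂circleMeasure).re ≤ c * Real.exp (-n) := by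
      intro j
      obtain ⟨C, hC⟩ := hmb j
      refine H _ (hmH j) C _ (Real.exp_pos _).le hC ?_
      filter_upwards [hmJ j] with θ h h1 h2
      exact (h h1 h2).le
    have h2 : Tendsto (fun j => ∫ θ in I, κ θ * m j θ ∂circleMeasure) atTop
        (𝓝 (∫ θ in I, κ θ * Complex.exp ((-(κ θ).arg : ℝ) * Complex.I) ∂circleMeasure)) := by
      refine tendsto_integral_of_dominated_convergence (fun θ => ‖κ θ‖) ?_ hκ.norm ?_ ?_
      · exact fun j => hκm.aestronglyMeasurable.mul
          (Lp.stronglyMeasurable _).aestronglyMeasurable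
      · intro j
        filter_upwards [(ae_restrict_iff' hI).2 (hmI j)] with θ h
        rw [norm_mul, h, mul_one]
      · filter_upwards [hlim] with θ h
        exact h.const_mul _
    have h3 : ∀ θ, κ θ * Complex.exp ((-(κ θ).arg : ℝ) * Complex.I) = (‖κ θ‖ : ℂ) := by
      intro θ
      nth_rw 1 [← Complex.norm_mul_exp_arg_mul_I (κ θ)]
      rw [mul_assoc, ← Complex.exp_add]
      simp
    simp only [h3] at h2
    rw [integral_complex_ofReal] at h2
    have h4 := (Complex.continuous_re.tendsto _).comp h2
    rw [Complex.ofReal_re] at h4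
    exact le_of_tendsto' h4 h1
  have hlim : Tendsto (fun n : ℕ => c * Real.exp (-n)) atTop (𝓝 0) := by
    have := (Real.tendsto_exp_neg_atTop_nhds_zero.comp tendsto_natCast_atTop_atTop).const_mul c
    rw [mul_zero] at this
    exact this
  have h0 : ∫ θ in I, ‖κ θ‖ ∂circleMeasure = 0 :=
    le_antisymm (ge_of_tendsto' hlim key) (integral_nonneg fun _ => norm_nonneg _)
  rw [integral_eq_zero_iff_of_nonneg (fun _ => norm_nonneg _) hκ.norm] at h0
  filter_upwards [h0] with θ h
  exact norm_eq_zero.1 h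

/-! ### Best approximation from a closed convex set -/

section Hilbert

variable {H K : Type*} [NormedAddCommGroup H] [InnerProductSpace ℝ H]
  [NormedAddCommGroup K] [InnerProductSpace ℝ K]

/-- A decreasing sequence of nonempty bounded closed convex sets of a Hilbert space
has nonempty intersection. -/
theorem nonempty_iInter_of_antitone_convex [CompleteSpace H] {C : ℕ → Set H} (hanti : Antitone C)
    (hne : ∀ n, (C n).Nonempty) (hcl : ∀ n, IsClosed (C n)) (hcv : ∀ n, Convex ℝ (C n))
    (hb : Bornology.IsBounded (C 0)) : (⋂ n, C n).Nonempty := by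
  have hmin : ∀ n, ∃ v ∈ C n, ∀ w ∈ C n, ‖v‖ ≤ ‖w‖ := by
    intro n
    obtain ⟨v, hv, hve⟩ :=
      exists_norm_eq_iInf_of_complete_convex (hne n) (hcl n).isComplete (hcv n) 0
    refine ⟨v, hv, fun w hw => ?_⟩
    rw [zero_sub, norm_neg] at hve
    rw [hve]
    refine (ciInf_le ⟨0, ?_⟩ (⟨w, hw⟩ : C n)).trans (by simp)
    rintro _ ⟨x, rfl⟩
    exact norm_nonneg _
  choose v hv hvmin using hmin
  obtain ⟨B, hB⟩ := hb.exists_norm_le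
  have hmono : Monotone fun n => ‖v n‖ ^ 2 := fun n k h =>
    pow_le_pow_left₀ (norm_nonneg _) (hvmin n _ (hanti h (hv k))) 2
  have hbdd : BddAbove (Set.range fun n => ‖v n‖ ^ 2) := by
    refine ⟨B ^ 2, ?_⟩
    rintro _ ⟨n, rfl⟩
    exact pow_le_pow_left₀ (norm_nonneg _) (hB _ (hanti (Nat.zero_le n) (hv n))) 2
  have hconv := tendsto_atTop_ciSup hmono hbdd
  set L := ⨆ n, ‖v n‖ ^ 2
  -- The midpoint of `v n` and `v k` lies in `C n`, so its norm is at least `‖v n‖`; the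
  -- parallelogram law does the rest.
  have hpar : ∀ n k, n ≤ k → ‖v n - v k‖ ^ 2 ≤ 2 * ‖v k‖ ^ 2 - 2 * ‖v n‖ ^ 2 := by
    intro n k h
    have h1 : (1 / 2 : ℝ) • v n + (1 / 2 : ℝ) • v k ∈ C n :=
      hcv n (hv n) (hanti h (hv k)) (by norm_num) (by norm_num) (by norm_num)
    have h2 := hvmin n _ h1
    rw [← smul_add, norm_smul, Real.norm_of_nonneg (by norm_num)] at h2
    have h3 := parallelogram_law_with_norm ℝ (v n) (v k)
    nlinarith [norm_nonneg (v n), norm_nonneg (v n + v k)]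
  have hcauchy : CauchySeq v := by
    rw [Metric.cauchySeq_iff']
    intro ε hε
    have h1 : ∀ᶠ n in atTop, L - ε ^ 2 / 4 < ‖v n‖ ^ 2 :=
      hconv.eventually (lt_mem_nhds (by have := pow_pos hε 2; linarith))
    obtain ⟨N, hN⟩ := h1.exists
    refine ⟨N, fun n hn => ?_⟩
    rw [dist_comm, dist_eq_norm]
    have h2 := hpar N n hn
    have h3 : ‖v n‖ ^ 2 ≤ L := le_ciSup hbdd n
    have := pow_pos hε 2
    exact lt_of_pow_lt_pow_left₀ 2 hε.le (by linarith)
  obtain ⟨x, hx⟩ := cauchySeq_tendsto_of_complete hcauchy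
  refine ⟨x, Set.mem_iInter.2 fun n => (hcl n).mem_of_tendsto hx ?_⟩
  filter_upwards [eventually_ge_atTop n] with k hk
  exact hanti hk (hv k)

theorem exists_minimizer [CompleteSpace H] (R : H →L[ℝ] K) (f : K) {C : Set H} (hne : C.Nonempty)
    (hcl : IsClosed C) (hcv : Convex ℝ C)
    (hb : ∀ B : ℝ, Bornology.IsBounded {x ∈ C | ‖f - R x‖ ≤ B}) :
    ∃ x ∈ C, ∀ y ∈ C, ‖f - R x‖ ≤ ‖f - R y‖ := by
  set d := sInf ((fun y => ‖f - R y‖) '' C) with hd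
  have hbelow : BddBelow ((fun y => ‖f - R y‖) '' C) := by
    refine ⟨0, ?_⟩
    rintro _ ⟨y, _, rfl⟩
    exact norm_nonneg _
  have hcont : Continuous fun x => ‖f - R x‖ := by fun_prop
  have hinter : (⋂ n : ℕ, {x ∈ C | ‖f - R x‖ ≤ d + 1 / ((n : ℝ) + 1)}).Nonempty := by
    refine nonempty_iInter_of_antitone_convex ?_ ?_ ?_ ?_ (hb _)
    · intro n k h x hx
      refine ⟨hx.1, hx.2.trans ?_⟩
      have := Nat.one_div_le_one_div (α := ℝ) h
      linarith
    · intro n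
      have h1 : d < d + 1 / ((n : ℝ) + 1) := lt_add_of_pos_right _ (by positivity)
      obtain ⟨_, ⟨y, hy, rfl⟩, h2⟩ := exists_lt_of_csInf_lt (hne.image _) h1
      exact ⟨y, hy, h2.le⟩
    · exact fun n => hcl.inter (isClosed_le hcont continuous_const)
    · intro n x hx y hy a b ha hb' hab
      refine ⟨hcv hx.1 hy.1 ha hb' hab, ?_⟩
      have h1 : f - R (a • x + b • y) = a • (f - R x) + b • (f - R y) := by
        rw [map_add, map_smul, map_smul, smul_sub, smul_sub]
        nth_rw 1 [← one_smul ℝ f]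
        rw [← hab, add_smul]
        abel
      rw [h1]
      refine (norm_add_le _ _).trans ?_
      rw [norm_smul, norm_smul, Real.norm_of_nonneg ha, Real.norm_of_nonneg hb']
      calc a * ‖f - R x‖ + b * ‖f - R y‖
          ≤ a * (d + 1 / ((n : ℝ) + 1)) + b * (d + 1 / ((n : ℝ) + 1)) := by
            gcongr
            exacts [hx.2, hy.2]
        _ = d + 1 / ((n : ℝ) + 1) := by rw [← add_mul, hab, one_mul]
  obtain ⟨x, hx⟩ := hinter
  rw [Set.mem_iInter] at hx
  refine ⟨x, (hx 0).1, fun y hy => ?_⟩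
  have h1 : ‖f - R x‖ ≤ d := by
    have h2 : Tendsto (fun n : ℕ => d + 1 / ((n : ℝ) + 1)) atTop (𝓝 (d + 0)) :=
      tendsto_one_div_add_atTop_nhds_zero_nat.const_add d
    rw [add_zero] at h2
    exact ge_of_tendsto' h2 fun n => (hx n).2
  exact h1.trans (csInf_le hbelow ⟨y, hy, rfl⟩)

/-- Strict convexity of the norm acts only on the images under `R`; injectivity has to come from
elsewhere. -/
theorem map_eq_of_minimizers (R : H →L[ℝ] K) (f : K) {C : Set H} (hcv : Convex ℝ C)
    {x y : H} (hx : x ∈ C) (hy : y ∈ C) (hxm : ∀ z ∈ C, ‖f - R x‖ ≤ ‖f - R z‖)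
    (hym : ∀ z ∈ C, ‖f - R y‖ ≤ ‖f - R z‖) : R x = R y := by
  have h1 : (1 / 2 : ℝ) • x + (1 / 2 : ℝ) • y ∈ C :=
    hcv hx hy (by norm_num) (by norm_num) (by norm_num)
  have h2 := hxm _ h1
  have h3 : f - R ((1 / 2 : ℝ) • x + (1 / 2 : ℝ) • y)
      = (1 / 2 : ℝ) • ((f - R x) + (f - R y)) := by
    rw [map_add, map_smul, map_smul]
    module
  rw [h3, norm_smul, Real.norm_of_nonneg (by norm_num)] at h2
  have h4 : ‖f - R x‖ = ‖f - R y‖ := le_antisymm (hxm y hy) (hym x hx)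
  have h5 := parallelogram_law_with_norm ℝ (f - R x) (f - R y)
  rw [← h4] at h5
  have h6 : ‖f - R x - (f - R y)‖ = 0 := by
    nlinarith [norm_nonneg (f - R x), norm_nonneg (f - R x - (f - R y)),
      norm_nonneg (f - R x + (f - R y))]
  rw [norm_eq_zero, sub_sub_sub_cancel_left, sub_eq_zero] at h6
  exact h6.symm

theorem inner_le_zero_of_forall_norm_le {φ h : K} {t₀ : ℝ} (ht₀ : 0 < t₀)
    (H : ∀ t, 0 < t → t ≤ t₀ → ‖φ‖ ≤ ‖φ - t • h‖) : inner ℝ φ h ≤ 0 := by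
  by_contra! hpos
  have key : ∀ t, 0 < t → t ≤ t₀ → 2 * inner ℝ φ h ≤ t * ‖h‖ ^ 2 := by
    intro t ht htt
    have h1 := pow_le_pow_left₀ (norm_nonneg _) (H t ht htt) 2
    rw [norm_sub_sq_real, inner_smul_right, norm_smul, Real.norm_of_nonneg ht.le, mul_pow] at h1
    have h2 : t * (2 * inner ℝ φ h) ≤ t * (t * ‖h‖ ^ 2) := by linarith
    exact le_of_mul_le_mul_left h2 ht
  set s := min t₀ (inner ℝ φ h / (‖h‖ ^ 2 + 1)) with hs
  have hs0 : 0 < s := lt_min ht₀ (by positivity)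
  have h1 := key s hs0 (min_le_left _ _)
  have h2 : s * (‖h‖ ^ 2 + 1) ≤ inner ℝ φ h := by
    rw [← le_div_iff₀ (by positivity)]
    exact min_le_right _ _
  linarith

end Hilbert

/-! ### The bounded extremal problem in a closed subspace -/

theorem errorOn_eq_enorm (I : Set UCircle) (f : Lp ℂ 2 (circleMeasure.restrict I))
    (g : Lp ℂ 2 circleMeasure) : errorOn I f g = ‖f - restrictTo I g‖ₑ := by
  rw [Lp.enorm_def, errorOn]
  refine eLpNorm_congr_ae ?_
  filter_upwards [Lp.coeFn_sub f (restrictTo I g), coeFn_restrictTo I g] with θ h1 h2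
  rw [h1, Pi.sub_apply, h2]

theorem errorOn_le_errorOn_iff (I : Set UCircle) (f : Lp ℂ 2 (circleMeasure.restrict I))
    (g h : Lp ℂ 2 circleMeasure) :
    errorOn I f g ≤ errorOn I f h ↔ ‖f - restrictTo I g‖ ≤ ‖f - restrictTo I h‖ := by
  rw [errorOn_eq_enorm, errorOn_eq_enorm, enorm_le_iff_norm_le]

theorem isClosed_boundedByOneOn (J : Set UCircle) :
    IsClosed {g : Lp ℂ 2 circleMeasure | BoundedByOneOn J g} := by
  refine IsSeqClosed.isClosed fun x g hx hlim => ?_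
  obtain ⟨ns, -, hae⟩ := (tendstoInMeasure_of_tendsto_Lp hlim).exists_seq_tendsto_ae
  have h1 : ∀ᵐ θ ∂circleMeasure.restrict J, ∀ k, ‖x k θ‖ ≤ 1 := ae_all_iff.2 hx
  filter_upwards [h1, ae_restrict_of_ae hae] with θ h2 h3
  exact le_of_tendsto' h3.norm fun k => h2 _

theorem isClosed_analyticCandidates (J : Set UCircle) : IsClosed (analyticCandidates J) :=
  isClosed_hardyH2.inter (isClosed_boundedByOneOn J)

theorem convex_analyticCandidates (J : Set UCircle) : Convex ℝ (analyticCandidates J) := by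
  intro x hx y hy a b ha hb hab
  refine ⟨(hardySubmodule.restrictScalars ℝ).convex hx.1 hy.1 ha hb hab, ?_⟩
  filter_upwards [hx.2, hy.2, ae_restrict_of_ae (Lp.coeFn_add (a • x) (b • y)),
    ae_restrict_of_ae (Lp.coeFn_smul a x), ae_restrict_of_ae (Lp.coeFn_smul b y)]
    with θ h1 h2 h3 h4 h5
  rw [h3, Pi.add_apply, h4, h5, Pi.smul_apply, Pi.smul_apply]
  refine (norm_add_le _ _).trans ?_
  rw [norm_smul, norm_smul, Real.norm_of_nonneg ha, Real.norm_of_nonneg hb]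
  nlinarith

theorem zero_mem_analyticCandidates (J : Set UCircle) : 0 ∈ analyticCandidates J := by
  refine ⟨hardySubmodule.zero_mem, ?_⟩
  filter_upwards [ae_restrict_of_ae (Lp.coeFn_zero ℂ 2 circleMeasure)] with θ h
  rw [h]
  simp

/-- The circle has mass one, so the part of `g` off `I` contributes at most `1`. This bounds the
sublevel sets of the error. -/
theorem norm_le_of_boundedByOneOn_compl {I : Set UCircle} (hI : MeasurableSet I)
    {g : Lp ℂ 2 circleMeasure} (hg : BoundedByOneOn Iᶜ g) : ‖g‖ ≤ ‖restrictTo I g‖ + 1 := by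
  have h1 : eLpNorm g 2 circleMeasure ≤
      eLpNorm g 2 (circleMeasure.restrict I) + eLpNorm g 2 (circleMeasure.restrict Iᶜ) := by
    rw [← eLpNorm_indicator_eq_eLpNorm_restrict hI,
      ← eLpNorm_indicator_eq_eLpNorm_restrict hI.compl]
    conv_lhs => rw [← Set.indicator_self_add_compl I (g : UCircle → ℂ)]
    exact eLpNorm_add_le ((Lp.aestronglyMeasurable g).indicator hI)
      ((Lp.aestronglyMeasurable g).indicator hI.compl) one_le_two
  have h2 : eLpNorm g 2 (circleMeasure.restrict Iᶜ) ≤ 1 := by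
    refine (eLpNorm_le_of_ae_bound hg).trans ?_
    rw [ENNReal.ofReal_one, mul_one, Measure.restrict_apply_univ]
    exact ENNReal.rpow_le_one prob_le_one (by positivity)
  have h3 : eLpNorm g 2 (circleMeasure.restrict I) = ‖restrictTo I g‖ₑ := by
    rw [Lp.enorm_def]
    exact eLpNorm_congr_ae (coeFn_restrictTo I g).symm
  rw [← Lp.enorm_def, h3] at h1
  have h4 : ‖g‖ₑ ≤ ‖restrictTo I g‖ₑ + 1 := h1.trans (by gcongr)
  rw [← ofReal_norm, ← ofReal_norm, ← ENNReal.ofReal_one,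
    ← ENNReal.ofReal_add (norm_nonneg _) zero_le_one] at h4
  exact (ENNReal.ofReal_le_ofReal_iff (by positivity)).1 h4

theorem restrictTo_injOn_hardyH2 {I : Set UCircle} (hI : MeasurableSet I)
    (hI0 : circleMeasure I ≠ 0) : Set.InjOn (restrictTo I) hardyH2 := by
  intro g hg h hh hgh
  rw [← sub_eq_zero]
  refine eq_zero_of_vanishes (hardySubmodule.sub_mem hg hh) hI hI0 ?_
  have h1 := (ae_restrict_iff' hI).1 (coeFn_restrictTo I g)
  have h2 := (ae_restrict_iff' hI).1 (coeFn_restrictTo I h)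
  filter_upwards [h1, h2, Lp.coeFn_sub g h] with θ p q r hθ
  rw [r, Pi.sub_apply, ← p hθ, ← q hθ, hgh, sub_self]

/-- Existence and uniqueness of the solution of the bounded extremal problem in a closed
subspace `W` of `L²`. -/
theorem existsUnique_minimizer {I : Set UCircle} (hI : MeasurableSet I)
    (hI0 : circleMeasure I ≠ 0) (f : Lp ℂ 2 (circleMeasure.restrict I))
    {W : Submodule ℂ (Lp ℂ 2 circleMeasure)} (hW : IsClosed (W : Set (Lp ℂ 2 circleMeasure))) :
    ∃! g, g ∈ analyticCandidates Iᶜ ∩ (W : Set (Lp ℂ 2 circleMeasure)) ∧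
      ∀ h ∈ analyticCandidates Iᶜ ∩ (W : Set (Lp ℂ 2 circleMeasure)),
        errorOn I f g ≤ errorOn I f h := by
  set R := (restrictTo I).restrictScalars ℝ with hR
  have hcv : Convex ℝ (analyticCandidates Iᶜ ∩ (W : Set (Lp ℂ 2 circleMeasure))) :=
    (convex_analyticCandidates _).inter (W.restrictScalars ℝ).convex
  simp only [errorOn_le_errorOn_iff]
  obtain ⟨g, hg, hmin⟩ := exists_minimizer R f
    (C := analyticCandidates Iᶜ ∩ (W : Set (Lp ℂ 2 circleMeasure)))
    ⟨0, zero_mem_analyticCandidates Iᶜ, W.zero_mem⟩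
    ((isClosed_analyticCandidates _).inter hW) hcv (by
      intro B
      refine isBounded_iff_forall_norm_le.2 ⟨‖f‖ + B + 1, fun x hx => ?_⟩
      have h1 := norm_le_of_boundedByOneOn_compl hI hx.1.1.2
      have h2 := norm_sub_norm_le (restrictTo I x) f
      rw [norm_sub_rev] at h2
      have h3 : ‖f - restrictTo I x‖ ≤ B := hx.2
      linarith)
  refine ⟨g, ⟨hg, hmin⟩, fun h hh => ?_⟩
  exact restrictTo_injOn_hardyH2 hI hI0 hh.1.1.1 hg.1.1
    (map_eq_of_minimizers R f hcv hh.1 hg hh.2 hmin)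

/-! ### Polynomials -/

/-- The trace of a polynomial as an element of `L²`. -/
noncomputable def polyToL2 : Polynomial ℂ →ₗ[ℂ] Lp ℂ 2 circleMeasure :=
  contToL2.toLinearMap ∘ₗ (Polynomial.aeval (fourier 1 : C(UCircle, ℂ))).toLinearMap

theorem aeval_fourier_apply (p : Polynomial ℂ) (θ : UCircle) :
    (Polynomial.aeval (fourier 1 : C(UCircle, ℂ)) p) θ = polyTrace p θ := by
  have := Polynomial.aeval_algHom_apply (ContinuousMap.evalAlgHom ℂ ℂ θ)
    (fourier 1 : C(UCircle, ℂ)) p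
  rw [polyTrace, ← fourier_one, ← Polynomial.coe_aeval_eq_eval]
  exact this.symm

theorem coeFn_polyToL2 (p : Polynomial ℂ) : polyToL2 p =ᵐ[circleMeasure] polyTrace p := by
  filter_upwards [coeFn_contToL2 (Polynomial.aeval (fourier 1 : C(UCircle, ℂ)) p)] with θ h
  rw [← aeval_fourier_apply, ← h]
  rfl

theorem polyToL2_mem_hardyH2 (p : Polynomial ℂ) : polyToL2 p ∈ hardyH2 := by
  have h : fourier 1 ∈ discAlgebra := fourierLp_mem_hardyH2 zero_le_one
  have h1 : Polynomial.aeval (fourier 1 : C(UCircle, ℂ)) p ∈ discAlgebra :=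
    Algebra.adjoin_le (Set.singleton_subset_iff.2 h) (Polynomial.aeval_mem_adjoin_singleton _ _)
  exact h1

theorem polyToL2_injective : Function.Injective polyToL2 := by
  intro p q hpq
  have h1 : Polynomial.aeval (fourier 1 : C(UCircle, ℂ)) p = Polynomial.aeval (fourier 1) q :=
    ContinuousMap.toLp_injective circleMeasure hpq
  refine Polynomial.eq_of_infinite_eval_eq p q ?_
  have hinf : (Set.range fun θ : UCircle => ((AddCircle.toCircle θ : Circle) : ℂ)).Infinite := by
    have : Infinite UCircle :=
      (AddCircle.equivIco (2 * π) 0).infinite_iff.2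
        (Set.Ico_infinite (by simpa using Real.two_pi_pos)).to_subtype
    exact Set.infinite_range_of_injective
      (Subtype.val_injective.comp (AddCircle.injective_toCircle Real.two_pi_pos.ne'))
  refine hinf.mono ?_
  rintro _ ⟨θ, rfl⟩
  have h2 := aeval_fourier_apply p θ
  rw [h1, aeval_fourier_apply] at h2
  exact h2.symm

theorem errorOn_polyToL2 (I : Set UCircle) (f : UCircle → ℂ) (p : Polynomial ℂ) :
    errorOn I f (polyToL2 p) = errorOn I f (polyTrace p) := by
  refine eLpNorm_congr_ae ?_
  filter_upwards [ae_restrict_of_ae (coeFn_polyToL2 p)] with θ h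
  rw [h]

theorem polyToL2_mem_candidates_iff (J : Set UCircle) (p : Polynomial ℂ) :
    polyToL2 p ∈ analyticCandidates J ↔ BoundedByOneOn J (polyTrace p) := by
  have h1 : BoundedByOneOn J (polyToL2 p) ↔ BoundedByOneOn J (polyTrace p) := by
    refine Filter.eventually_congr ?_
    filter_upwards [ae_restrict_of_ae (coeFn_polyToL2 p)] with θ h
    rw [h]
  exact ⟨fun h => h1.1 h.2, fun h => ⟨polyToL2_mem_hardyH2 p, h1.2 h⟩⟩

theorem existsUnique_isPBEPSolution {I : Set UCircle} (hI : MeasurableSet I)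
    (hI0 : circleMeasure I ≠ 0) (f : Lp ℂ 2 (circleMeasure.restrict I)) (n : ℕ) :
    ∃! k : Polynomial ℂ, IsPBEPSolution I n f k := by
  set W := (Polynomial.degreeLT ℂ (n + 1)).map polyToL2 with hWdef
  have : FiniteDimensional ℂ (Polynomial.degreeLT ℂ (n + 1)) :=
    (Polynomial.degreeLTEquiv ℂ (n + 1)).symm.finiteDimensional
  have hW : IsClosed (W : Set (Lp ℂ 2 circleMeasure)) := W.closed_of_finiteDimensional
  have hdeg : ∀ p : Polynomial ℂ, p ∈ Polynomial.degreeLT ℂ (n + 1) ↔ p.natDegree ≤ n := by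
    intro p
    rw [Polynomial.degreeLT_succ_eq_degreeLE, Polynomial.mem_degreeLE,
      Polynomial.natDegree_le_iff_degree_le]
  have hmem : ∀ p, polyToL2 p ∈ analyticCandidates Iᶜ ∩ (W : Set (Lp ℂ 2 circleMeasure)) ↔
      p ∈ polyCandidates Iᶜ n := by
    intro p
    have hpW : polyToL2 p ∈ (W : Set (Lp ℂ 2 circleMeasure)) ↔ p.natDegree ≤ n := by
      rw [← hdeg, hWdef, Submodule.map_coe, polyToL2_injective.mem_set_image, SetLike.mem_coe]
    rw [Set.mem_inter_iff, polyToL2_mem_candidates_iff, hpW, and_comm]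
    rfl
  have hsol : ∀ k, IsPBEPSolution I n f k ↔
      (polyToL2 k ∈ analyticCandidates Iᶜ ∩ (W : Set (Lp ℂ 2 circleMeasure)) ∧
      ∀ h ∈ analyticCandidates Iᶜ ∩ (W : Set (Lp ℂ 2 circleMeasure)),
        errorOn I f (polyToL2 k) ≤ errorOn I f h) := by
    intro k
    rw [IsPBEPSolution, hmem, errorOn_polyToL2]
    refine and_congr_right fun hk => ⟨fun h g hg => ?_, fun h => ?_⟩
    · obtain ⟨p, -, rfl⟩ := hg.2
      rw [h, errorOn_polyToL2]
      exact iInf₂_le p ((hmem p).1 hg)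
    · refine le_antisymm (le_iInf₂ fun p hp => ?_) (iInf₂_le k hk)
      rw [← errorOn_polyToL2 I f p]
      exact h _ ((hmem p).2 hp)
  obtain ⟨g, hg, huniq⟩ := existsUnique_minimizer hI hI0 f hW
  obtain ⟨k, -, rfl⟩ := hg.1.2
  refine ⟨k, (hsol k).2 hg, fun p hp => polyToL2_injective (huniq _ ((hsol p).1 hp))⟩

theorem isABEPSolution_iff (I : Set UCircle) (f : Lp ℂ 2 (circleMeasure.restrict I))
    (g : Lp ℂ 2 circleMeasure) :
    IsABEPSolution I f g ↔ g ∈ analyticCandidates Iᶜ ∧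
      ∀ h ∈ analyticCandidates Iᶜ, errorOn I f g ≤ errorOn I f h := by
  refine and_congr_right fun hg => ⟨fun h k hk => ?_, fun h => ?_⟩
  · rw [h]
    exact iInf₂_le k hk
  · exact le_antisymm (le_iInf₂ h) (iInf₂_le g hg)

theorem existsUnique_isABEPSolution {I : Set UCircle} (hI : MeasurableSet I)
    (hI0 : circleMeasure I ≠ 0) (f : Lp ℂ 2 (circleMeasure.restrict I)) :
    ∃! g₀ : Lp ℂ 2 circleMeasure, IsABEPSolution I f g₀ := by
  simp only [isABEPSolution_iff]
  simpa using existsUnique_minimizer hI hI0 f (W := ⊤) isClosed_univ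

/-! ### The constraint is saturated -/

theorem variational_inequality {I : Set UCircle} {f : Lp ℂ 2 (circleMeasure.restrict I)}
    {g h : Lp ℂ 2 circleMeasure} (hg : IsABEPSolution I f g) (hh : h ∈ hardyH2) {t₀ : ℝ}
    (ht₀ : 0 < t₀)
    (hb : ∀ t : ℝ, 0 < t → t ≤ t₀ → ∀ᵐ θ ∂circleMeasure.restrict Iᶜ, ‖g θ + t * h θ‖ ≤ 1) :
    (∫ θ in I, star (f θ - g θ) * h θ ∂circleMeasure).re ≤ 0 := by
  rw [isABEPSolution_iff] at hg
  have h1 : inner ℝ (f - restrictTo I g) (restrictTo I h) ≤ 0 := by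
    refine inner_le_zero_of_forall_norm_le ht₀ fun t ht htt => ?_
    have h2 : g + (t : ℂ) • h ∈ analyticCandidates Iᶜ := by
      refine ⟨hardySubmodule.add_mem hg.1.1 (hardySubmodule.smul_mem _ hh), ?_⟩
      filter_upwards [hb t ht htt, ae_restrict_of_ae (Lp.coeFn_add g ((t : ℂ) • h)),
        ae_restrict_of_ae (Lp.coeFn_smul (t : ℂ) h)] with θ p q r
      rw [q, Pi.add_apply, r]
      exact p
    have h3 := (errorOn_le_errorOn_iff I f _ _).1 (hg.2 _ h2)
    rw [map_add, map_smul, ← sub_sub] at h3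
    exact h3
  rw [L2.inner_def] at h1
  have hint : Integrable (fun θ => star (f θ - g θ) * h θ) (circleMeasure.restrict I) :=
    (((Lp.memLp f).sub ((Lp.memLp g).restrict I)).star).integrable_mul ((Lp.memLp h).restrict I)
  have h4 : (∫ θ in I, star (f θ - g θ) * h θ ∂circleMeasure).re =
      ∫ θ in I, (star (f θ - g θ) * h θ).re ∂circleMeasure := (integral_re hint).symm
  rw [h4]
  refine le_of_eq_of_le (integral_congr_ae ?_) h1
  filter_upwards [Lp.coeFn_sub f (restrictTo I g), coeFn_restrictTo I g, coeFn_restrictTo I h]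
    with θ p q r
  rw [p, Pi.sub_apply, q, r, inner_real_eq_re_mul_add_im_mul]
  simp only [RCLike.star_def, Complex.mul_re, Complex.conj_re, Complex.conj_im]
  ring

theorem exists_Lp_mul_of_bounded (g : Lp ℂ 2 circleMeasure) {m : Lp ℂ 2 circleMeasure} {C : ℝ}
    (hC : ∀ᵐ θ ∂circleMeasure, ‖m θ‖ ≤ C) (hg : g ∈ hardyH2) (hm : m ∈ hardyH2) :
    ∃ h ∈ hardyH2, h =ᵐ[circleMeasure] fun θ => g θ * m θ := by
  have hmem : MemLp (fun θ => g θ * m θ) 2 circleMeasure := by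
    refine (Lp.memLp g).of_le_mul (c := C)
      ((Lp.aestronglyMeasurable g).mul (Lp.aestronglyMeasurable m)) ?_
    filter_upwards [hC] with θ h
    rw [norm_mul, mul_comm]
    gcongr
  exact ⟨hmem.toLp _, mem_hardyH2_of_ae_eq_mul hg hm hmem.coeFn_toLp, hmem.coeFn_toLp⟩

theorem measurable_star_sub (I : Set UCircle) (f : Lp ℂ 2 (circleMeasure.restrict I))
    (g : Lp ℂ 2 circleMeasure) : Measurable fun θ => star (f θ - g θ) :=
  continuous_star.measurable.comp
    ((Lp.stronglyMeasurable f).measurable.sub (Lp.stronglyMeasurable g).measurable)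

theorem memLp_star_sub (I : Set UCircle) (f : Lp ℂ 2 (circleMeasure.restrict I))
    (g : Lp ℂ 2 circleMeasure) :
    MemLp (fun θ => star (f θ - g θ)) 2 (circleMeasure.restrict I) :=
  ((Lp.memLp f).sub ((Lp.memLp g).restrict I)).star

/-- If the zero function solves the problem, then `f` vanishes. -/
theorem ae_eq_of_solution_zero {I : Set UCircle} (hI : MeasurableSet I)
    (hJ0 : circleMeasure Iᶜ ≠ 0) {f : Lp ℂ 2 (circleMeasure.restrict I)}
    (hg : IsABEPSolution I f 0) :
    f =ᵐ[circleMeasure.restrict I] (0 : Lp ℂ 2 circleMeasure) := by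
  have hz := Lp.coeFn_zero ℂ 2 circleMeasure
  -- Near `g = 0` every bounded Hardy function is an admissible direction, so `E` can be all of the
  -- complement of `I` and `c = 0`.
  have key := ae_eq_zero_of_pairing_le hI hI.compl disjoint_compl_right hJ0
    (measurable_star_sub I f 0) ((memLp_star_sub I f 0).integrable one_le_two) (c := 0) (by
      intro m hm C η _ hC _
      rw [zero_mul]
      refine variational_inequality hg hm (t₀ := 1 / (|C| + 1)) (by positivity)
        fun t ht htt => ?_
      filter_upwards [ae_restrict_of_ae hz, ae_restrict_of_ae hC] with θ h1 h2
      rw [h1, Pi.zero_apply, zero_add, norm_mul, Complex.norm_real, Real.norm_of_nonneg ht.le]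
      rw [le_div_iff₀ (by positivity)] at htt
      have h3 : ‖m θ‖ ≤ |C| + 1 := by linarith [le_abs_self C]
      exact (mul_le_mul_of_nonneg_left h3 ht.le).trans htt)
  filter_upwards [key] with θ h
  exact sub_eq_zero.1 (star_eq_zero.1 h)

/-- Where `z` is slack, the factor is at most `1 + ε` and `(1 - ε)(1 + ε) ≤ 1`. Where `w` is small,
subtracting `η` keeps the factor within `(1 - tη) + tη = 1`. -/
theorem norm_mul_one_add_le_one {z w : ℂ} {t ε K η : ℝ} (hz : ‖z‖ ≤ 1) (ht : 0 < t)
    (hε : t * K ≤ ε) (hη : t * η ≤ 1)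
    (h : ‖z‖ ≤ 1 - ε ∧ ‖w - η‖ ≤ K ∨ ‖w‖ ≤ η) :
    ‖z + t * (z * (w - η))‖ ≤ 1 := by
  have hfac : z + t * (z * (w - η)) = z * (1 + t * (w - η)) := by ring
  rw [hfac, norm_mul]
  rcases h with ⟨h1, h2⟩ | h1
  · have h3 : ‖(1 : ℂ) + t * (w - η)‖ ≤ 1 + ε := by
      refine (norm_add_le _ _).trans ?_
      rw [norm_one, norm_mul, Complex.norm_real, Real.norm_of_nonneg ht.le]
      have := mul_le_mul_of_nonneg_left h2 ht.le
      linarith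
    have h4 : 0 ≤ 1 - ε := (norm_nonneg _).trans h1
    calc ‖z‖ * ‖(1 : ℂ) + t * (w - η)‖ ≤ (1 - ε) * (1 + ε) :=
          mul_le_mul h1 h3 (norm_nonneg _) h4
      _ ≤ 1 := by nlinarith [sq_nonneg ε]
  · have h3 : ‖(1 : ℂ) + t * (w - η)‖ ≤ 1 := by
      have h4 : (1 : ℂ) + t * (w - η) = ((1 - t * η : ℝ) : ℂ) + t * w := by
        push_cast
        ring
      rw [h4]
      refine (norm_add_le _ _).trans ?_
      rw [norm_mul, Complex.norm_real, Complex.norm_real, Real.norm_of_nonneg ht.le,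
        Real.norm_of_nonneg (by linarith)]
      have := mul_le_mul_of_nonneg_left h1 ht.le
      linarith
    exact mul_le_one₀ hz (norm_nonneg _) h3

/-- If the constraint is slack on a set of positive measure, then the error `f - g` is
annihilated by `g`: perturb `g` to `g (1 + t (m - η))`. -/
theorem ae_mul_eq_zero_of_solution {I E : Set UCircle} (hI : MeasurableSet I)
    (hE : MeasurableSet E) (hIE : Disjoint I E) (hE0 : circleMeasure E ≠ 0)
    {f : Lp ℂ 2 (circleMeasure.restrict I)} {g : Lp ℂ 2 circleMeasure}
    (hg : IsABEPSolution I f g) {ε : ℝ} (hε : 0 < ε) (hgE : ∀ θ ∈ E, ‖g θ‖ ≤ 1 - ε) :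
    ∀ᵐ θ ∂circleMeasure.restrict I, star (f θ - g θ) * g θ = 0 := by
  have hint : IntegrableOn (fun θ => star (f θ - g θ) * g θ) I circleMeasure :=
    (memLp_star_sub I f g).integrable_mul ((Lp.memLp g).restrict I)
  -- The constant `c` comes from the term `-η g` of the perturbation `g (m - η)` and does not depend
  -- on `m`.
  refine ae_eq_zero_of_pairing_le hI hE hIE hE0
    ((measurable_star_sub I f g).mul (Lp.stronglyMeasurable g).measurable) hint
    (c := (∫ θ in I, star (f θ - g θ) * g θ ∂circleMeasure).re) ?_
  intro m hm C η hη hC hmη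
  obtain ⟨k, hk, hkm⟩ := exists_Lp_mul_of_bounded g hC hg.1.1 hm
  have hh : k - (η : ℂ) • g ∈ hardyH2 :=
    hardySubmodule.sub_mem hk (hardySubmodule.smul_mem _ hg.1.1)
  have hhe : (k - (η : ℂ) • g : Lp ℂ 2 circleMeasure) =ᵐ[circleMeasure]
      fun θ => g θ * (m θ - η) := by
    filter_upwards [hkm, Lp.coeFn_sub k ((η : ℂ) • g), Lp.coeFn_smul (η : ℂ) g] with θ p q r
    rw [q, Pi.sub_apply, p, r, Pi.smul_apply, smul_eq_mul]
    ring
  set K : ℝ := |C| + η with hK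
  have hK0 : 0 ≤ K := by positivity
  have hvar := variational_inequality hg hh (t₀ := min (ε / (K + 1)) (1 / (η + 1)))
    (lt_min (by positivity) (by positivity)) (by
      intro t ht htt
      have ht1 : t * (K + 1) ≤ ε := by
        rw [← le_div_iff₀ (by positivity)]
        exact htt.trans (min_le_left _ _)
      have ht2 : t * (η + 1) ≤ 1 := by
        rw [← le_div_iff₀ (by positivity)]
        exact htt.trans (min_le_right _ _)
      filter_upwards [ae_restrict_of_ae hhe, ae_restrict_of_ae hC, ae_restrict_of_ae hmη,
        hg.1.2, ae_restrict_mem hI.compl] with θ h1 h2 h3 h4 h5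
      rw [h1]
      refine norm_mul_one_add_le_one (ε := ε) (K := K) h4 ht (by linarith) (by linarith) ?_
      by_cases hθ : θ ∈ E
      · left
        refine ⟨hgE θ hθ, (norm_sub_le _ _).trans ?_⟩
        rw [Complex.norm_real, Real.norm_of_nonneg hη, hK]
        linarith [le_abs_self C]
      · exact Or.inr (h3 h5 hθ))
  have h1 : Integrable (fun θ => star (f θ - g θ) * k θ) (circleMeasure.restrict I) :=
    (memLp_star_sub I f g).integrable_mul ((Lp.memLp k).restrict I)
  have h2 : ∫ θ in I, star (f θ - g θ) * (k - (η : ℂ) • g : Lp ℂ 2 circleMeasure) θ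
      ∂circleMeasure = (∫ θ in I, star (f θ - g θ) * g θ * m θ ∂circleMeasure) -
        η * ∫ θ in I, star (f θ - g θ) * g θ ∂circleMeasure := by
    have h3 : (fun θ => star (f θ - g θ) * g θ * m θ) =ᵐ[circleMeasure.restrict I]
        fun θ => star (f θ - g θ) * k θ := by
      filter_upwards [ae_restrict_of_ae hkm] with θ p
      rw [p, mul_assoc]
    rw [integral_congr_ae h3, ← integral_const_mul, ← integral_sub h1 (hint.const_mul _)]
    refine integral_congr_ae ?_
    filter_upwards [ae_restrict_of_ae hhe, ae_restrict_of_ae hkm] with θ p q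
    rw [p, q]
    ring
  rw [h2, Complex.sub_re, Complex.re_ofReal_mul] at hvar
  linarith

theorem norm_eq_one_of_solution {I : Set UCircle} (hI : MeasurableSet I)
    {f : Lp ℂ 2 (circleMeasure.restrict I)} {g : Lp ℂ 2 circleMeasure}
    (hg : IsABEPSolution I f g)
    (hf : ¬ ∃ g ∈ hardyH2, BoundedByOneOn Iᶜ g ∧ f =ᵐ[circleMeasure.restrict I] g) :
    ∀ᵐ θ ∂(circleMeasure.restrict Iᶜ), ‖g θ‖ = 1 := by
  by_contra hcon
  apply hf
  have hmeas : Measurable fun θ => ‖g θ‖ := (Lp.stronglyMeasurable g).norm.measurable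
  -- The multiplicative perturbation is trivial at `g = 0`, hence the separate case.
  by_cases hg0 : g = 0
  · subst hg0
    refine ⟨0, hardySubmodule.zero_mem, hg.1.2, ae_eq_of_solution_zero hI (fun h => hcon ?_) hg⟩
    rw [Measure.restrict_eq_zero.2 h]
    exact ae_zero.le trivial
  · refine ⟨g, hg.1.1, hg.1.2, ?_⟩
    have hE : ∃ n : ℕ, circleMeasure (Iᶜ ∩ {θ | ‖g θ‖ ≤ 1 - 1 / ((n : ℝ) + 1)}) ≠ 0 := by
      by_contra! h
      refine hcon ?_
      have h1 : ∀ᵐ θ ∂circleMeasure.restrict Iᶜ, ∀ n : ℕ, 1 - 1 / ((n : ℝ) + 1) < ‖g θ‖ := by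
        rw [ae_all_iff]
        intro n
        rw [ae_restrict_iff' hI.compl, ae_iff]
        convert h n using 2
        ext θ
        simp
      filter_upwards [h1, hg.1.2] with θ h2 h3
      refine le_antisymm h3 ?_
      have h4 : Tendsto (fun n : ℕ => 1 - 1 / ((n : ℝ) + 1)) atTop (𝓝 (1 - 0)) :=
        tendsto_one_div_add_atTop_nhds_zero_nat.const_sub 1
      rw [sub_zero] at h4
      exact le_of_tendsto' h4 fun n => (h2 n).le
    obtain ⟨n, hn⟩ := hE
    have key := ae_mul_eq_zero_of_solution hI
      (hI.compl.inter (measurableSet_le hmeas measurable_const))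
      (disjoint_compl_right.mono_right Set.inter_subset_left) hn hg
      (ε := 1 / ((n : ℝ) + 1)) (by positivity) (fun θ hθ => hθ.2)
    -- A nonzero Hardy function has a null zero set, so the factor `g` can be cancelled in `key`.
    have hne : ∀ᵐ θ ∂circleMeasure, g θ ≠ 0 := by
      by_contra h
      refine hg0 (eq_zero_of_vanishes hg.1.1 (E := {θ | ‖g θ‖ = 0})
        (measurableSet_eq_fun hmeas measurable_const) ?_ ?_)
      · intro h0
        refine h ?_
        rw [ae_iff]
        convert h0 using 3
        simp
      · exact ae_of_all _ fun θ hθ => norm_eq_zero.1 hθ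
    filter_upwards [key, ae_restrict_of_ae hne] with θ h1 h2
    exact sub_eq_zero.1 (star_eq_zero.1 ((mul_eq_zero.1 h1).resolve_right h2))

/-! ### Arcs -/

theorem IsOpenArc.isOpen {A : Set UCircle} (hA : IsOpenArc A) : IsOpen A := by
  obtain ⟨a, b, -, -, rfl⟩ := hA
  exact QuotientAddGroup.isOpenMap_coe _ isOpen_Ioo

theorem IsOpenArc.nonempty {A : Set UCircle} (hA : IsOpenArc A) : A.Nonempty := by
  obtain ⟨a, b, hab, -, rfl⟩ := hA
  exact (Set.nonempty_Ioo.2 hab).image _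

theorem IsFiniteUnionOfOpenArcs.isOpen {I : Set UCircle} (hI : IsFiniteUnionOfOpenArcs I) :
    IsOpen I := by
  obtain ⟨S, -, -, hS, rfl⟩ := hI
  exact isOpen_sUnion fun A hA => (hS A hA).isOpen

theorem IsFiniteUnionOfOpenArcs.nonempty {I : Set UCircle} (hI : IsFiniteUnionOfOpenArcs I) :
    I.Nonempty := by
  obtain ⟨S, -, ⟨A, hA⟩, hS, rfl⟩ := hI
  exact (hS A hA).nonempty.mono (Set.subset_sUnion_of_mem hA)

theorem theorem1 (I : Set UCircle) (hI : IsFiniteUnionOfOpenArcs I)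
    (hJ : (interior Iᶜ).Nonempty) (f : Lp ℂ 2 (circleMeasure.restrict I)) :
    (∀ n : ℕ, ∃! k : Polynomial ℂ, IsPBEPSolution I n f k) ∧
    (∃! g₀ : Lp ℂ 2 circleMeasure, IsABEPSolution I f g₀) ∧
    (∀ g₀ : Lp ℂ 2 circleMeasure, IsABEPSolution I f g₀ →
      (¬ ∃ g ∈ hardyH2, BoundedByOneOn Iᶜ g ∧ f =ᵐ[circleMeasure.restrict I] g) →
      ∀ᵐ θ ∂(circleMeasure.restrict Iᶜ), ‖g₀ θ‖ = 1) := by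
  have hIm : MeasurableSet I := hI.isOpen.measurableSet
  have hI0 : circleMeasure I ≠ 0 := (hI.isOpen.measure_pos _ hI.nonempty).ne'
  exact ⟨existsUnique_isPBEPSolution hIm hI0 f, existsUnique_isABEPSolution hIm hI0 f,
    fun g₀ hg hf => norm_eq_one_of_solution hIm hg hf⟩
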